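/- Work with finite relational signatures $\sigma$ of unary and binary predicates containing a distinguished binary predicate $T$, which is always interpreted as a transitive relation. Let $$\Psi=\forall x\forall y\,\psi_0\;\wedge\;\bigwedge_{i=1}^{m}\gamma_i\;\wedge\;\bigwedge_{i=1}^{m'}\delta_i$$ be a sentence of the two-variable fragment with transitive witnesses in normal form, i.e. each $\gamma_i$ is $\forall x\exists y(Txy\wedge\neg Tyx\wedge\psi_i)$ or $\forall x\exists y(\neg Txy\wedge Tyx\wedge\psi_i)$, each $\delta_i$ is $\forall x\exists y(Txy\wedge Tyx\wedge\psi_i')$, and $\psi_0,\psi_i,\psi'_i$ are quantifier-free formulas (with equality) in $x,y$. Definitions, for a $\sigma$-structure $\mathfrak A$ with universe $A$. A clique is a maximal set $X\subseteq A$ such that $Tab$ and $Tba$ for all distinct $a,b\in X$. Write $a<X$ (resp. $X<a$) if $Tab\wedge\neg Tba$ (resp. $Tba\wedge\neg Tab$) for all $b\in X$. The splice of a clique $X$ is the triple consisting of the isomorphism type of the substructure induced by $X$, the set of atomic 1-types of elements $a<X$, and the set of atomic 1-types of elements $a>X$. Let $s(\mathfrak A)$ be the number of splices of cliques of $\mathfrak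 A$, and let $K(\mathfrak A)$ be the union of those cliques whose splice is realized by no other clique. Let $W_i(a)$ be the set of elements $b\ne a$ that witness $\gamma_i$ for $a$. For $h\in\mathbb N$ put $\mathbb M=(m+1)\cdot s(\mathfrak A)^2\cdot h$. For pairwise disjoint sets $S_0,S_1,\dots$ and $j<k$, $j'<k'$, the connection types $\langle S_{j'},S_{k'}\rangle$ and $\langle S_j,S_k\rangle$ are equivalent if there are isomorphisms $f:\mathfrak A{\restriction}S_{j'}\to\mathfrak A{\restriction}S_j$ and $g:\mathfrak A{\restriction}S_{k'}\to\mathfrak A{\restriction}S_k$ such that $(b,c)$ and $(f(b),g(c))$ realize the same atomic 2-type for all $b\in S_{j'}$, $c\in S_{k'}$. A regular model of $\Psi$ (with clique bound $h$) is a model $\mathfrak A\models\Psi$ whose cliques all have at most $h$ elements and such that either $A$ is finite and $A=K(\mathfrak A)$, or $A$ has an infinite partition $S_0,S_1,\dots$ into nonempty unions of cliques such that 1. $K(\mathfrak A)\subseteq S_0$; 2. $|S_j|\le\mathbb M$ for all $j\ge 0$; 3. for all $j\ge0$, all $a\in S_0\cup\dots\cup S_j$ and all $i\le m$: if $W_i(a)\cap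 S_0=\emptyset$, then $W_i(a)\cap S_{j+1}\neq\emptyset$; 4. all connection types $\langle S_j,S_k\rangle$ with $1\le j<k$ (in particular all $\langle S_k,S_{k+1}\rangle$ with $k\ge1$) are equivalent, and all connection types $\langle S_0,S_k\rangle$ with $k\ge1$ are equivalent. Lemma. There are absolute constants $c,d\in\mathbb N$ such that every satisfiable normal-form sentence $\Psi$ of the fragment with transitive witnesses, over any such signature $\sigma$, has a regular model $\mathfrak A$ with clique bound $h=2^{c|\sigma|}$, where $|\sigma|$ is the number of predicates, and with $s(\mathfrak A)\le 2^{2^{d|\sigma|}}$. -/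

import Mathlib

universe u v w

namespace FO2T

/-! ### Two-variable logic over a signature of unary and binary predicates

`U` is the set of unary predicates, `B` the set of binary predicates, and `T : B` is the
distinguished binary predicate that has to be interpreted as a transitive relation. -/

/-- A relational structure with universe `A` over unary predicates `U` and binary ones `B`. -/
structure Str (U : Type u) (B : Type v) (A : Type w) where
  un : U → A → Prop
  bin : B → A → A → Prop

/-- The two variables. -/
inductive Var where
  | x
  | y

/-- Quantifier-free formulas (with equality) in the two variables. -/
inductive QF (U : Type u) (B : Type v) where
  | eq (s t : Var) : QF U B
  | un (p : U) (s : Var) : QF U B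
  | bin (r : B) (s t : Var) : QF U B
  | neg (φ : QF U B) : QF U B
  | and (φ ψ : QF U B) : QF U B
  | or (φ ψ : QF U B) : QF U B

/-- The value of a variable under the assignment `x ↦ a`, `y ↦ b`. -/
def Var.val {A : Type w} (a b : A) : Var → A
  | .x => a
  | .y => b

/-- `φ.Holds 𝔄 a b` means `𝔄 ⊨ φ[a, b]`. -/
def QF.Holds {U : Type u} {B : Type v} {A : Type w} (𝔄 : Str U B A) (a b : A) : QF U B → Prop
  | .eq s t => s.val a b = t.val a b
  | .un p s => 𝔄.un p (s.val a b)
  | .bin r s t => 𝔄.bin r (s.val a b) (t.val a b)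
  | .neg φ => ¬ φ.Holds 𝔄 a b
  | .and φ ψ => φ.Holds 𝔄 a b ∧ ψ.Holds 𝔄 a b
  | .or φ ψ => φ.Holds 𝔄 a b ∨ ψ.Holds 𝔄 a b

/-- The direction of a witness outside the clique: `Txy ∧ ¬Tyx` or `¬Txy ∧ Tyx`. -/
inductive Dir where
  | right
  | left

/-- The transitive guard `Txy ∧ ¬Tyx` or `¬Txy ∧ Tyx`, evaluated at `(a, b)`. -/
def Dir.Guard {U : Type u} {B : Type v} {A : Type w} (T : B) (𝔄 : Str U B A) (a b : A) :
    Dir → Prop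
  | .right => 𝔄.bin T a b ∧ ¬ 𝔄.bin T b a
  | .left => ¬ 𝔄.bin T a b ∧ 𝔄.bin T b a

/-- A normal-form sentence of the fragment with transitive witnesses:
`∀x∀y ψ₀ ∧ ⋀_{i<m} ∀x∃y (guard_{dᵢ}(x,y) ∧ ψᵢ) ∧ ⋀_{i<m'} ∀x∃y (Txy ∧ Tyx ∧ ψ'ᵢ)`,
where every `dᵢ` is one of the two directions and all `ψ` are quantifier-free. -/
structure NormalForm (U : Type u) (B : Type v) where
  univ : QF U B
  m : ℕ
  dir : Fin m → Dir
  gamma : Fin m → QF U B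
  m' : ℕ
  delta : Fin m' → QF U B

/-- `IsModel T Ψ 𝔄`: `T` is transitive in the (nonempty) structure `𝔄`, and `𝔄 ⊨ Ψ`. -/
structure IsModel {U : Type u} {B : Type v} {A : Type w} (T : B) (Ψ : NormalForm U B)
    (𝔄 : Str U B A) : Prop where
  nonempty : Nonempty A
  trans : ∀ a b c : A, 𝔄.bin T a b → 𝔄.bin T b c → 𝔄.bin T a c
  univ : ∀ a b : A, Ψ.univ.Holds 𝔄 a b
  gamma : ∀ (i : Fin Ψ.m) (a : A), ∃ b : A,
    (Ψ.dir i).Guard T 𝔄 a b ∧ (Ψ.gamma i).Holds 𝔄 a b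
  delta : ∀ (i : Fin Ψ.m') (a : A), ∃ b : A,
    (𝔄.bin T a b ∧ 𝔄.bin T b a) ∧ (Ψ.delta i).Holds 𝔄 a b

/-- `Ψ` has a model (with universe in `Type w`). -/
def Satisfiable {U : Type u} {B : Type v} (T : B) (Ψ : NormalForm U B) : Prop :=
  ∃ (A : Type w) (𝔄 : Str U B A), IsModel T Ψ 𝔄

/-- The set `Wᵢ(a)` of proper witnesses of `a` for the `i`-th conjunct
`∀x∃y (guard_{dᵢ}(x,y) ∧ ψᵢ)`. -/
def Wit {U : Type u} {B : Type v} {A : Type w} (T : B) (Ψ : NormalForm U B) (𝔄 : Str U B A)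
    (i : Fin Ψ.m) (a : A) : Set A :=
  {b | ((Ψ.dir i).Guard T 𝔄 a b ∧ (Ψ.gamma i).Holds 𝔄 a b) ∧ a ≠ b}

/-! ### Atomic types and induced substructures -/

/-- Atomic 1-types: a truth value for each atom `P x` and each atom `R x x`. -/
abbrev OneType (U : Type u) (B : Type v) := (U → Prop) × (B → Prop)

/-- Atomic 2-types of pairs of distinct elements: the 1-types of the two elements and a truth
value for each atom `R x y` and each atom `R y x`. -/
abbrev TwoType (U : Type u) (B : Type v) :=
  OneType U B × OneType U B × (B → Prop) × (B → Prop)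

/-- The 1-type realized by `a`. -/
def tp {U : Type u} {B : Type v} {A : Type w} (𝔄 : Str U B A) (a : A) : OneType U B :=
  (fun p => 𝔄.un p a, fun r => 𝔄.bin r a a)

/-- The 2-type realized by `(a, b)`, for `a ≠ b`. -/
def tp₂ {U : Type u} {B : Type v} {A : Type w} (𝔄 : Str U B A) (a b : A) : TwoType U B :=
  (tp 𝔄 a, tp 𝔄 b, fun r => 𝔄.bin r a b, fun r => 𝔄.bin r b a)

/-- `f` is an isomorphism between the substructures of `𝔄` induced by `X` and by `Y`. -/
def IsIso {U : Type u} {B : Type v} {A : Type w} (𝔄 : Str U B A) {X Y : Set A}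
    (f : X ≃ Y) : Prop :=
  (∀ (p : U) (a : X), 𝔄.un p (f a) ↔ 𝔄.un p a) ∧
  (∀ (r : B) (a b : X), 𝔄.bin r (f a) (f b) ↔ 𝔄.bin r a b)

/-! ### Cliques and splices -/

/-- Any two distinct elements of `X` are related by `T` in both directions. -/
def TConnected {U : Type u} {B : Type v} {A : Type w} (T : B) (𝔄 : Str U B A)
    (X : Set A) : Prop :=
  ∀ a ∈ X, ∀ b ∈ X, a ≠ b → 𝔄.bin T a b ∧ 𝔄.bin T b a

/-- Cliques are maximal `T`-connected sets. -/
def IsClique {U : Type u} {B : Type v} {A : Type w} (T : B) (𝔄 : Str U B A)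
    (X : Set A) : Prop :=
  Maximal (TConnected T 𝔄) X

/-- The type of all cliques of `𝔄`. -/
abbrev Clique {U : Type u} {B : Type v} {A : Type w} (T : B) (𝔄 : Str U B A) :=
  {X : Set A // IsClique T 𝔄 X}

/-- All 1-types of elements `a` with `a < X`, i.e. `T a b` and not `T b a` for all `b ∈ X`. -/
def InTypes {U : Type u} {B : Type v} {A : Type w} (T : B) (𝔄 : Str U B A)
    (X : Set A) : Set (OneType U B) :=
  {t | ∃ a, tp 𝔄 a = t ∧ ∀ b ∈ X, 𝔄.bin T a b ∧ ¬ 𝔄.bin T b a}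

/-- All 1-types of elements `a` with `X < a`, i.e. `T b a` and not `T a b` for all `b ∈ X`. -/
def OutTypes {U : Type u} {B : Type v} {A : Type w} (T : B) (𝔄 : Str U B A)
    (X : Set A) : Set (OneType U B) :=
  {t | ∃ a, tp 𝔄 a = t ∧ ∀ b ∈ X, 𝔄.bin T b a ∧ ¬ 𝔄.bin T a b}

/-- Two cliques realize the same splice: the induced substructures are isomorphic, and the sets
of 1-types of elements below, and of elements above, are the same. -/
def spliceSetoid {U : Type u} {B : Type v} {A : Type w} (T : B) (𝔄 : Str U B A) :
    Setoid (Clique T 𝔄) where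
  r X Y := (∃ f : X.1 ≃ Y.1, IsIso 𝔄 f) ∧
    InTypes T 𝔄 X.1 = InTypes T 𝔄 Y.1 ∧ OutTypes T 𝔄 X.1 = OutTypes T 𝔄 Y.1
  iseqv :=
    { refl := fun X => ⟨⟨Equiv.refl _, fun _ _ => Iff.rfl, fun _ _ _ => Iff.rfl⟩, rfl, rfl⟩
      symm := by
        rintro X Y ⟨⟨f, h1, h2⟩, h3, h4⟩
        refine ⟨⟨f.symm, fun p a => ?_, fun r a b => ?_⟩, h3.symm, h4.symm⟩
        · simpa using (h1 p (f.symm a)).symm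
        · simpa using (h2 r (f.symm a) (f.symm b)).symm
      trans := by
        rintro X Y Z ⟨⟨f, h1, h2⟩, h3, h4⟩ ⟨⟨g, k1, k2⟩, k3, k4⟩
        exact ⟨⟨f.trans g, fun p a => (k1 p (f a)).trans (h1 p a),
          fun r a b => (k2 r (f a) (f b)).trans (h2 r a b)⟩, h3.trans k3, h4.trans k4⟩ }

/-- Splices are classes of cliques that realize the same splice. -/
abbrev Splice {U : Type u} {B : Type v} {A : Type w} (T : B) (𝔄 : Str U B A) :=
  Quotient (spliceSetoid T 𝔄)

/-- The union `K(𝔄)` of all cliques whose splice is realized by no other clique. -/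
def K {U : Type u} {B : Type v} {A : Type w} (T : B) (𝔄 : Str U B A) : Set A :=
  {a | ∃ X : Clique T 𝔄, a ∈ X.1 ∧ ∀ Y : Clique T 𝔄, spliceSetoid T 𝔄 X Y → Y = X}

/-- The bound `(m + 1) · s² · h` on the size of segments, where `m` is the number of conjuncts
`∀x∃y (guard_{dᵢ}(x,y) ∧ ψᵢ)` of `Ψ`, `s` is the number of splices of `𝔄`, and `h` is the bound
on the size of cliques. -/
noncomputable def segmentBound {U : Type u} {B : Type v} {A : Type w} (T : B)
    (Ψ : NormalForm U B) (𝔄 : Str U B A) (h : ℕ) : ℕ :=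
  (Ψ.m + 1) * Nat.card (Splice T 𝔄) ^ 2 * h

/-! ### Narrow and regular models -/

/-- `S 0, S 1, …` is an infinite partition of the universe, into sets of cliques, that witnesses
that `𝔄` is narrow. -/
structure IsNarrowPartition {U : Type u} {B : Type v} {A : Type w} (T : B)
    (Ψ : NormalForm U B) (𝔄 : Str U B A) (h : ℕ) (S : ℕ → Set A) : Prop where
  nonempty : ∀ j, (S j).Nonempty
  disjoint : ∀ j k, j ≠ k → Disjoint (S j) (S k)
  cover : ⋃ j, S j = Set.univ
  clique_subset : ∀ (j : ℕ) (X : Set A), IsClique T 𝔄 X → (X ∩ S j).Nonempty → X ⊆ S j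
  K_subset : K T 𝔄 ⊆ S 0
  card_le : ∀ j, (S j).encard ≤ (segmentBound T Ψ 𝔄 h : ℕ∞)
  witness : ∀ j, ∀ k ≤ j, ∀ a ∈ S k, ∀ i : Fin Ψ.m,
    Wit T Ψ 𝔄 i a ∩ S 0 = ∅ → (Wit T Ψ 𝔄 i a ∩ S (j + 1)).Nonempty

/-- The connection types `⟨S j', S k'⟩` and `⟨S j, S k⟩` are equivalent. -/
def ConnEquiv {U : Type u} {B : Type v} {A : Type w} (𝔄 : Str U B A) (S : ℕ → Set A)
    (j' k' j k : ℕ) : Prop :=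
  j' < k' ∧ j < k ∧ ∃ (f : S j' ≃ S j) (g : S k' ≃ S k), IsIso 𝔄 f ∧ IsIso 𝔄 g ∧
    ∀ (b : S j') (c : S k'), tp₂ 𝔄 (b : A) (c : A) = tp₂ 𝔄 (f b : A) (g c : A)

/-- `𝔄` is a regular model of `Ψ`, with clique size bounded by `h`: it is a finite model that
consists of cliques with unique splices only, or it has an infinite partition as above in which
all connection types `⟨S j, S k⟩` with `1 ≤ j < k` (in particular the types `⟨S k, S (k+1)⟩` with
`1 ≤ k`) are equivalent and all connection types `⟨S 0, S k⟩` with `1 ≤ k` are equivalent. -/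
def IsRegularModel {U : Type u} {B : Type v} {A : Type w} (T : B) (Ψ : NormalForm U B)
    (𝔄 : Str U B A) (h : ℕ) : Prop :=
  IsModel T Ψ 𝔄 ∧
  (∀ X : Set A, IsClique T 𝔄 X → X.encard ≤ (h : ℕ∞)) ∧
  ((Finite A ∧ K T 𝔄 = Set.univ) ∨
    ∃ S : ℕ → Set A, IsNarrowPartition T Ψ 𝔄 h S ∧
      (∀ j' k' j k : ℕ, 1 ≤ j' → j' < k' → 1 ≤ j → j < k → ConnEquiv 𝔄 S j' k' j k) ∧
      (∀ k' k : ℕ, 1 ≤ k' → 1 ≤ k → ConnEquiv 𝔄 S 0 k' 0 k))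

end FO2T

/-!
The proof has two steps, and both change 2-types freely: a structure is a model of `Ψ` as soon as
all its 2-types are realized in some model and every element realizes the 2-types that its
witnesses require. The lemma `exists_str_of_types` builds structures from prescribed 2-types.

*Small cliques.* In a model, all cliques can be thinned simultaneously to exponential size
(`exists_thinning`, `IsModel.exists_small_cliques`). Each element chooses one witness for each
2-type that it realizes. In each class of elements of the same clique and 1-type, three disjoint
stocks of spare elements are reserved, with one spare element for each 2-type, and an element of
colour `k` redirects its choices to the stock of colour `k + 1`. An element that is itself chosen by
a spare element is not redirected; there are few such elements for each class, so their
choices can be kept. Classes with too few elements to reserve stocks are kept as a whole.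

*Regularity.* Let all cliques be small. The profile of a clique consists of its 1-types and of the
1-types below and above it. Let `Prec p q` mean that all 1-types of `p`, and all those below it,
occur below `q`, and dually. This relation is transitive, it holds between the profiles of
comparable cliques, and whenever it holds the two profiles can be related by `T` without realizing
new 2-types. A clique is royal if its profile occurs once and does not precede itself. All other
cliques can be copied without limit: two copies of the same profile are either incomparable, like
the two cliques that realize the profile in the given model, or linearly ordered at will. The new
order (`CopyLt`) is `Prec`, with ties between equivalent profiles resolved by a linear order of
positions.

The regular model (`IsModel.exists_isLayered`) has one clique of each profile and the witness
cliques of royal elements in layer `0`, and in each later layer, for each conjunct, a copy of one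
clique of each profile that is not royal. Royal elements keep their relations to all others as far
as the order permits, so that witnesses which are royal or required by royal elements survive.
All other requirements are met in every later layer, by the copies reserved for the conjunct,
which are positioned above or below all lower layers. The 2-types are chosen by a rule that sees
the levels only through their order, so the connection types are equivalent. Since the profiles are
preserved, they inject into the splices of the new model, which gives the bound on the
segments; the number of splices is bounded by counting (`finite_splice_and_card_le`).
-/

namespace FO2T

open Function

section

variable {U : Type u} {B : Type v} {A : Type w} {T : B} {𝔄 : Str U B A}

/-! ### Atomic types and quantifier-free formulas -/

/-- The 2-type of `(b, a)`, computed from the 2-type of `(a, b)`. -/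
def flipType (τ : TwoType U B) : TwoType U B := (τ.2.1, τ.1, τ.2.2.2, τ.2.2.1)

theorem flipType_flipType (τ : TwoType U B) : flipType (flipType τ) = τ := rfl

theorem flipType_tp₂ (𝔄 : Str U B A) (a b : A) : flipType (tp₂ 𝔄 a b) = tp₂ 𝔄 b a := rfl

/-- The statement includes the degenerate case `a = b`, in which `tp₂ 𝔄 a a` carries the
same information as the 1-type of `a`. -/
theorem QF.holds_congr {A' : Type*} {𝔄 : Str U B A} {𝔅 : Str U B A'} {a b : A} {a' b' : A'}
    (h : tp₂ 𝔄 a b = tp₂ 𝔅 a' b') (e : a = b ↔ a' = b') (φ : QF U B) :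
    φ.Holds 𝔄 a b ↔ φ.Holds 𝔅 a' b' := by
  simp only [tp₂, tp, Prod.mk.injEq, funext_iff, eq_iff_iff] at h
  obtain ⟨⟨h1, h2⟩, ⟨h3, h4⟩, h5, h6⟩ := h
  have e' : b = a ↔ b' = a' := by rw [eq_comm, e, eq_comm]
  induction φ with
  | eq s t => cases s <;> cases t <;> simp [QF.Holds, Var.val, e, e']
  | un p s => cases s <;> simp [QF.Holds, Var.val, h1, h3]
  | bin r s t => cases s <;> cases t <;> simp [QF.Holds, Var.val, h2, h4, h5, h6]
  | neg φ ih => simp [QF.Holds, ih]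
  | and φ ψ ih1 ih2 => simp [QF.Holds, ih1, ih2]
  | or φ ψ ih1 ih2 => simp [QF.Holds, ih1, ih2]

theorem bin_congr {A' : Type*} {𝔄 : Str U B A} {𝔅 : Str U B A'} {a b : A} {a' b' : A'}
    (h : tp₂ 𝔄 a b = tp₂ 𝔅 a' b') (r : B) :
    (𝔄.bin r a b ↔ 𝔅.bin r a' b') ∧ (𝔄.bin r b a ↔ 𝔅.bin r b' a') := by
  simp only [tp₂, tp, Prod.mk.injEq, funext_iff, eq_iff_iff] at h
  exact ⟨h.2.2.1 r, h.2.2.2 r⟩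

theorem guard_congr {A' : Type*} {𝔄 : Str U B A} {𝔅 : Str U B A'} {a b : A} {a' b' : A'}
    (h : tp₂ 𝔄 a b = tp₂ 𝔅 a' b') (T : B) (d : Dir) :
    d.Guard T 𝔄 a b ↔ d.Guard T 𝔅 a' b' := by
  cases d <;> simp [Dir.Guard, (bin_congr h T).1, (bin_congr h T).2]

theorem tp₂_self_congr {A' : Type*} {𝔄 : Str U B A} {𝔅 : Str U B A'} {a : A} {a' : A'}
    (h : tp 𝔄 a = tp 𝔅 a') : tp₂ 𝔄 a a = tp₂ 𝔅 a' a' := by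
  have h' := h
  simp only [tp, Prod.mk.injEq] at h'
  simp only [tp₂, h, h'.2]

theorem bin_self_congr {A' : Type*} {𝔄 : Str U B A} {𝔅 : Str U B A'} {a : A} {a' : A'}
    (h : tp 𝔄 a = tp 𝔅 a') (r : B) : 𝔄.bin r a a ↔ 𝔅.bin r a' a' :=
  (bin_congr (tp₂_self_congr h) r).1

theorem Dir.Guard.ne {T : B} {𝔄 : Str U B A} {a b : A} {d : Dir} (h : d.Guard T 𝔄 a b) :
    a ≠ b := by
  rintro rfl
  cases d <;> simp [Dir.Guard] at h

theorem card_oneType [Fintype U] [Fintype B] :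
    Nat.card (OneType U B) = 2 ^ (Fintype.card U + Fintype.card B) := by
  simp only [OneType, Nat.card_prod, Nat.card_fun, Nat.card_eq_fintype_card,
    Fintype.card_prop, ← pow_add]

theorem card_twoType_le [Fintype U] [Fintype B] :
    Nat.card (TwoType U B) ≤ 2 ^ (4 * (Fintype.card U + Fintype.card B)) := by
  simp only [TwoType, OneType, Nat.card_prod, Nat.card_fun, Nat.card_eq_fintype_card,
    Fintype.card_prop, ← pow_add]
  exact Nat.pow_le_pow_right (by norm_num) (by omega)

/-! ### Structures with prescribed 2-types -/

/-- A structure on `E` is determined by its 2-types. Given for all `x ≠ y` a nonempty set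
`Ok x y` of admissible 2-types, and a consistent partial assignment `Want` of admissible
2-types, there is a structure that follows `Want` where it is defined and is admissible
everywhere. The linear order on the keys decides for which of the pairs `(x, y)` and `(y, x)`
a choice is made; that choice depends on the sets alone, so the structure inherits every
symmetry of `Ok`, `Want` and the order. -/
theorem exists_str_of_types {E : Type w} {L : Type*} [LinearOrder L] (key : E → L)
    (hkey : Injective key) (t : E → OneType U B) (Ok Want : E → E → Set (TwoType U B))
    (ok_tp : ∀ x y, ∀ τ ∈ Ok x y, τ.1 = t x ∧ τ.2.1 = t y)
    (ok_flip : ∀ x y, ∀ τ ∈ Ok x y, flipType τ ∈ Ok y x)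
    (ok_ne : ∀ x y, x ≠ y → (Ok x y).Nonempty)
    (want_ok : ∀ x y, x ≠ y → Want x y ⊆ Ok x y)
    (want_unique : ∀ x y, ∀ τ ∈ Want x y, ∀ τ' ∈ Want x y, τ = τ')
    (want_flip : ∀ x y, x ≠ y → ∀ τ ∈ Want x y, ∀ τ' ∈ Want y x, τ' = flipType τ) :
    ∃ 𝔅 : Str U B E, (∀ x, tp 𝔅 x = t x) ∧ (∀ x y, x ≠ y → tp₂ 𝔅 x y ∈ Ok x y) ∧
      (∀ x y, x ≠ y → ∀ τ ∈ Want x y, tp₂ 𝔅 x y = τ) ∧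
      ∀ x y x' y', x ≠ y → x' ≠ y' → (key x < key y ↔ key x' < key y') →
        Ok x y = Ok x' y' → Ok y x = Ok y' x' → Want x y = Want x' y' →
        Want y x = Want y' x' → tp₂ 𝔅 x y = tp₂ 𝔅 x' y' := by
  classical
  let C : Set (TwoType U B) → Set (TwoType U B) → Set (TwoType U B) → TwoType U B :=
    fun P Q R => Classical.epsilon fun τ =>
      τ ∈ P ∧ (∀ τ' ∈ Q, τ = τ') ∧ ∀ τ' ∈ R, τ = flipType τ'
  let c : E → E → TwoType U B := fun x y => C (Ok x y) (Want x y) (Want y x)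
  have hc : ∀ x y, x ≠ y → c x y ∈ Ok x y ∧ (∀ τ' ∈ Want x y, c x y = τ') ∧
      ∀ τ' ∈ Want y x, c x y = flipType τ' := by
    intro x y hxy
    refine Classical.epsilon_spec (p := fun τ => τ ∈ Ok x y ∧ (∀ τ' ∈ Want x y, τ = τ') ∧
      ∀ τ' ∈ Want y x, τ = flipType τ') ?_
    by_cases h1 : (Want x y).Nonempty
    · obtain ⟨τ, hτ⟩ := h1
      exact ⟨τ, want_ok x y hxy hτ, want_unique x y τ hτ,
        fun τ' h' => want_flip y x hxy.symm τ' h' τ hτ⟩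
    by_cases h2 : (Want y x).Nonempty
    · obtain ⟨τ, hτ⟩ := h2
      refine ⟨flipType τ, ok_flip y x τ (want_ok y x hxy.symm hτ),
        fun τ' h' => absurd ⟨τ', h'⟩ h1, fun τ' h' => ?_⟩
      rw [want_unique y x τ hτ τ' h']
    obtain ⟨τ, hτ⟩ := ok_ne x y hxy
    exact ⟨τ, hτ, fun τ' h' => absurd ⟨τ', h'⟩ h1, fun τ' h' => absurd ⟨τ', h'⟩ h2⟩
  let 𝔅 : Str U B E :=
    { un := fun p x => (t x).1 p
      bin := fun r x y => if key x < key y then (c x y).2.2.1 r else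
        if key y < key x then (c y x).2.2.2 r else (t x).2 r }
  have htp : ∀ x, tp 𝔅 x = t x := fun x => by simp [tp, 𝔅]
  have h2 : ∀ x y, key x < key y → tp₂ 𝔅 x y = c x y := by
    intro x y h
    obtain ⟨e1, e2⟩ := ok_tp x y _ (hc x y (fun e => h.ne (congrArg key e))).1
    have : tp₂ 𝔅 x y = (tp 𝔅 x, tp 𝔅 y, (c x y).2.2.1, (c x y).2.2.2) := by
      simp [tp₂, 𝔅, h, h.not_gt]
    rw [this, htp, htp, ← e1, ← e2]
  have h3 : ∀ x y, key y < key x → tp₂ 𝔅 x y = flipType (c y x) := by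
    intro x y h
    rw [← h2 y x h, flipType_tp₂]
  have key_ne : ∀ x y, x ≠ y → ¬ key x < key y → key y < key x := fun x y h h' =>
    lt_of_le_of_ne (not_lt.1 h') fun e => h (hkey e.symm)
  refine ⟨𝔅, htp, ?_, ?_, ?_⟩
  · intro x y hxy
    by_cases h : key x < key y
    · rw [h2 x y h]
      exact (hc x y hxy).1
    · rw [h3 x y (key_ne x y hxy h)]
      exact ok_flip _ _ _ (hc y x hxy.symm).1
  · intro x y hxy τ hτ
    by_cases h : key x < key y
    · rw [h2 x y h]
      exact (hc x y hxy).2.1 τ hτ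
    · rw [h3 x y (key_ne x y hxy h), (hc y x hxy.symm).2.2 τ hτ, flipType_flipType]
  · intro x y x' y' hxy hxy' hk ho ho' hw hw'
    have e1 : c x y = c x' y' := by simp only [c, ho, hw, hw']
    have e2 : c y x = c y' x' := by simp only [c, ho', hw, hw']
    by_cases h : key x < key y
    · rw [h2 x y h, h2 x' y' (hk.1 h), e1]
    · rw [h3 x y (key_ne x y hxy h), h3 x' y' (key_ne x' y' hxy' (mt hk.2 h)), e2]

/-! ### Thinning the classes of a partition -/

theorem exists_subset_range_of_embedding {ι : Type*} {C : Set A} (e : C ↪ ι) [Nonempty A] :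
    ∃ f : ι → A, C ⊆ Set.range f := by
  by_cases hC : C.Nonempty
  · have : Nonempty C := hC.to_subtype
    refine ⟨fun i => (invFun e i : C), fun a ha => ⟨e ⟨a, ha⟩, ?_⟩⟩
    simp [leftInverse_invFun e.injective ⟨a, ha⟩]
  · refine ⟨fun _ => Classical.arbitrary A, ?_⟩
    rw [Set.not_nonempty_iff_eq_empty.1 hC]
    exact Set.empty_subset _

theorem encard_le_of_subset_range {ι : Type*} [Finite ι] {C : Set A} {f : ι → A}
    (h : C ⊆ Set.range f) : C.encard ≤ (Nat.card ι : ℕ∞) := by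
  refine (Set.encard_le_encard h).trans ?_
  rw [← Set.image_univ]
  refine (Set.encard_image_le _ _).trans ?_
  rw [← Set.Finite.cast_ncard_eq Set.finite_univ, Set.ncard_univ]

theorem nonempty_embedding_fin {C : Set A} {h : ℕ} (hC : C.encard ≤ (h : ℕ∞)) :
    Nonempty (C ↪ Fin h) := by
  have hfin : C.Finite := Set.finite_of_encard_le_coe hC
  have := hfin.fintype
  refine Embedding.nonempty_of_card_le ?_
  rw [← hfin.cast_ncard_eq, Nat.cast_le] at hC
  rwa [Fintype.card_fin, ← Nat.card_eq_fintype_card, Nat.card_coe_set_eq]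

/-- Every set either contains the image of an injection of `ι`, or is covered by a map
from `ι`. -/
theorem exists_injective_or_subset_range (ι : Type*) (C : Set A) [Nonempty A] :
    ∃ f : ι → A, (Injective f ∧ ∀ i, f i ∈ C) ∨ C ⊆ Set.range f := by
  rcases Embedding.total C ι with ⟨⟨e⟩⟩ | ⟨⟨e⟩⟩
  · obtain ⟨f, hf⟩ := exists_subset_range_of_embedding e
    exact ⟨f, Or.inr hf⟩
  · exact ⟨fun i => e i, Or.inl ⟨fun i j hij => e.injective (Subtype.ext hij), fun i => (e i).2⟩⟩

/-- The universe of a structure is partitioned into the fibres of `κ`. All fibres can be thinned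
simultaneously to exponential size, changing some 2-types between the remaining elements, so
that every remaining element still realizes all 2-types that it realized before, and the 2-types
between two fibres are among the old ones between these fibres.

A chosen witness `v a τ` is replaced by one from a stock of spare elements of the same fibre and
1-type, unless the spare elements of that class are too few, or one of them has chosen `a` as a
witness; in these cases `v a τ` is kept. There are three stocks in each class, and the elements of
one stock take their witnesses from the next, so that no two elements demand different 2-types
of the pair that they form. -/
theorem exists_thinning [Fintype U] [Fintype B] [Nonempty B] [Nonempty A] {Q : Type*}
    (𝔄 : Str U B A) (κ : A → Q) :
    ∃ (D : Set A) (𝔅 : Str U B D), D.Nonempty ∧ (∀ x : D, tp 𝔅 x = tp 𝔄 (x : A)) ∧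
      (∀ x y : D, x ≠ y → ∃ a b, a ≠ b ∧ κ a = κ x ∧ κ b = κ y ∧ tp₂ 𝔅 x y = tp₂ 𝔄 a b) ∧
      (∀ (x : D) (c : A), c ≠ x → ∃ y : D, y ≠ x ∧ tp₂ 𝔅 x y = tp₂ 𝔄 (x : A) c) ∧
      ∀ q, {a ∈ D | κ a = q}.encard ≤
        ((2 ^ (16 * (Fintype.card U + Fintype.card B)) : ℕ) : ℕ∞) := by
  classical
  have hv : ∀ (a : A) (τ : TwoType U B), ∃ b : A, (∃ c, c ≠ a ∧ tp₂ 𝔄 a c = τ) →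
      b ≠ a ∧ tp₂ 𝔄 a b = τ := by
    intro a τ
    by_cases h : ∃ c, c ≠ a ∧ tp₂ 𝔄 a c = τ
    · obtain ⟨c, hc⟩ := h
      exact ⟨c, fun _ => hc⟩
    · exact ⟨a, fun h' => absurd h' h⟩
  choose v hv using hv
  -- The first component of an index is the number of the stock.
  let ι := Fin 3 × TwoType U B
  let cls : A → Q × OneType U B := fun a => (κ a, tp 𝔄 a)
  have hf : ∀ p : Q × OneType U B, ∃ f : ι → A, (Injective f ∧ ∀ i, f i ∈ {a | cls a = p}) ∨
      {a | cls a = p} ⊆ Set.range f := fun p => exists_injective_or_subset_range _ _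
  choose f hf using hf
  let Large : Q × OneType U B → Prop := fun p => Injective (f p) ∧ ∀ i, cls (f p i) = p
  have hsmall : ∀ a, ¬ Large (cls a) → ∃ i, f (cls a) i = a := fun a h =>
    ((hf (cls a)).resolve_left h) rfl
  have hcol : ∀ a, ∃ k : Fin 3, ∀ j τ, Large (cls a) → f (cls a) (j, τ) = a → k = j := by
    intro a
    by_cases h : ∃ j τ, Large (cls a) ∧ f (cls a) (j, τ) = a
    · obtain ⟨j, τ, hL, h⟩ := h
      refine ⟨j, fun j' τ' _ h' => ?_⟩
      have := hL.1 (h.trans h'.symm)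
      exact congrArg Prod.fst this
    · exact ⟨0, fun j τ hL h' => absurd ⟨j, τ, hL, h'⟩ h⟩
  choose col hcol using hcol
  have col_f : ∀ p j τ, Large p → col (f p (j, τ)) = j := by
    intro p j τ hL
    refine hcol _ j τ ?_ ?_ <;> rw [hL.2]
    exact hL
  let D : Set A := {a | (∃ i, f (cls a) i = a) ∨ ∃ i τ τ', v (v (f (cls a) i) τ) τ' = a}
  let Free : A → Q × OneType U B → Prop := fun a p => Large p ∧ ∀ i τ', v (f p i) τ' ≠ a
  let pick : A → TwoType U B → A := fun a τ =>
    if Free a (cls (v a τ)) then f (cls (v a τ)) (col a + 1, τ) else v a τ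
  have pick_cls : ∀ a τ, cls (pick a τ) = cls (v a τ) := by
    intro a τ
    simp only [pick]
    split_ifs with h
    · exact h.1.2 _
    · rfl
  have pick_mem : ∀ a τ, pick a τ ∈ D := by
    intro a τ
    by_cases h : Free a (cls (v a τ))
    · refine Or.inl ⟨(col a + 1, τ), ?_⟩
      rw [pick_cls]
      simp only [pick, if_pos h]
    · have e : pick a τ = v a τ := by simp only [pick, if_neg h]
      rw [e]
      by_cases hL : Large (cls (v a τ))
      · simp only [Free, not_and, not_forall, not_not] at h
        obtain ⟨i, τ', h⟩ := h hL
        exact Or.inr ⟨i, τ', τ, by rw [h]⟩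
      · exact Or.inl (hsmall _ hL)
  let Re : A → TwoType U B → Prop := fun a τ => ∃ c, c ≠ a ∧ tp₂ 𝔄 a c = τ
  have col_ne : ∀ k : Fin 3, k + 1 ≠ k := by decide
  have col_ne' : ∀ k : Fin 3, k + 1 + 1 ≠ k := by decide
  have pick_ne : ∀ a τ, Re a τ → pick a τ ≠ a := by
    intro a τ hR e
    by_cases h : Free a (cls (v a τ))
    · have := col_f _ (col a + 1) τ h.1
      simp only [pick, if_pos h] at e
      rw [e] at this
      exact col_ne _ this.symm
    · simp only [pick, if_neg h] at e
      exact (hv a τ hR).1 e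
  have pick_inj : ∀ a τ τ', Re a τ → Re a τ' → pick a τ = pick a τ' → τ = τ' := by
    intro a τ τ' hR hR' e
    have ec : cls (v a τ) = cls (v a τ') := by rw [← pick_cls, ← pick_cls, e]
    by_cases h : Free a (cls (v a τ))
    · simp only [pick, if_pos h, if_pos (ec ▸ h : Free a (cls (v a τ')))] at e
      rw [← ec] at e
      exact congrArg Prod.snd (h.1.1 e)
    · simp only [pick, if_neg h, if_neg (ec ▸ h : ¬ Free a (cls (v a τ')))] at e
      rw [← (hv a τ hR).2, ← (hv a τ' hR').2, e]
  have pick_flip : ∀ a b τ τ', Re a τ → Re b τ' → pick a τ = b → pick b τ' = a →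
      τ' = flipType τ := by
    -- An element is not redirected to a spare element that has chosen it.
    have mixed : ∀ a b τ τ', pick a τ = b → pick b τ' = a → Free a (cls (v a τ)) →
        ¬ Free b (cls (v b τ')) → False := by
      intro a b τ τ' e e' h h'
      simp only [pick, if_pos h] at e
      simp only [pick, if_neg h'] at e'
      exact h.2 (col a + 1, τ) τ' (by rw [e, e'])
    intro a b τ τ' hR hR' e e'
    by_cases h : Free a (cls (v a τ))
    · by_cases h' : Free b (cls (v b τ'))
      · have e1 := col_f _ (col a + 1) τ h.1
        have e2 := col_f _ (col b + 1) τ' h'.1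
        simp only [pick, if_pos h] at e
        simp only [pick, if_pos h'] at e'
        rw [e] at e1
        rw [e', e1] at e2
        exact absurd e2.symm (col_ne' _)
      · exact (mixed a b τ τ' e e' h h').elim
    · by_cases h' : Free b (cls (v b τ'))
      · exact (mixed b a τ' τ e' e h' h).elim
      · simp only [pick, if_neg h] at e
        simp only [pick, if_neg h'] at e'
        rw [← (hv a τ hR).2, ← (hv b τ' hR').2, e, e', flipType_tp₂]
  obtain ⟨𝔅, h1, h2, h3, -⟩ := exists_str_of_types (embeddingToCardinal : D ↪ Cardinal)
    embeddingToCardinal.injective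
    (fun x => tp 𝔄 (x : A))
    (fun x y => {τ | ∃ a b, a ≠ b ∧ cls a = cls x ∧ cls b = cls y ∧ τ = tp₂ 𝔄 a b})
    (fun x y => {τ | Re x τ ∧ pick x τ = y})
    (by
      rintro x y τ ⟨a, b, -, ha, hb, rfl⟩
      exact ⟨congrArg Prod.snd ha, congrArg Prod.snd hb⟩)
    (by
      rintro x y τ ⟨a, b, hab, ha, hb, rfl⟩
      exact ⟨b, a, hab.symm, hb, ha, rfl⟩)
    (fun x y hxy => ⟨_, x, y, fun e => hxy (Subtype.ext e), rfl, rfl, rfl⟩)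
    (by
      rintro x y hxy τ ⟨hR, e⟩
      refine ⟨x, v x τ, (hv x τ hR).1.symm, rfl, ?_, (hv x τ hR).2.symm⟩
      rw [← pick_cls, e])
    (by
      rintro x y τ ⟨hR, e⟩ τ' ⟨hR', e'⟩
      exact pick_inj x τ τ' hR hR' (e.trans e'.symm))
    (by
      rintro x y - τ ⟨hR, e⟩ τ' ⟨hR', e'⟩
      exact pick_flip x y τ τ' hR hR' e e')
  refine ⟨D, 𝔅, ⟨_, pick_mem (Classical.arbitrary A) (Classical.arbitrary _)⟩, h1, ?_, ?_, ?_⟩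
  · intro x y hxy
    obtain ⟨a, b, hab, ha, hb, e⟩ := h2 x y hxy
    exact ⟨a, b, hab, congrArg Prod.fst ha, congrArg Prod.fst hb, e⟩
  · intro x c hc
    have hR : Re x (tp₂ 𝔄 x c) := ⟨c, hc, rfl⟩
    have hne : (⟨pick x (tp₂ 𝔄 x c), pick_mem _ _⟩ : D) ≠ x := fun e =>
      pick_ne x _ hR (congrArg Subtype.val e)
    exact ⟨_, hne, h3 x _ hne.symm _ ⟨hR, rfl⟩⟩
  · intro q
    let g : OneType U B × (Fin 3 × TwoType U B) × Option (TwoType U B × TwoType U B) → A :=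
      fun p => match p.2.2 with
        | none => f (q, p.1) p.2.1
        | some (τ, τ') => v (v (f (q, p.1) p.2.1) τ) τ'
    have hsub : {a ∈ D | κ a = q} ⊆ Set.range g := by
      rintro a ⟨h, rfl⟩
      rcases h with ⟨i, h⟩ | ⟨i, τ, τ', h⟩
      · exact ⟨(tp 𝔄 a, i, none), h⟩
      · exact ⟨(tp 𝔄 a, i, some (τ, τ')), h⟩
    refine (encard_le_of_subset_range hsub).trans (Nat.cast_le.2 ?_)
    set n := Fintype.card U + Fintype.card B with hn
    have hW : Nat.card (TwoType U B) ≤ 2 ^ (4 * n) := card_twoType_le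
    have hO : Nat.card (Option (TwoType U B × TwoType U B)) ≤ 2 ^ (8 * n) + 1 := by
      rw [Finite.card_option, Nat.card_prod]
      have := Nat.mul_le_mul hW hW
      rw [← pow_add] at this
      rw [show 8 * n = 4 * n + 4 * n by ring]
      omega
    rw [Nat.card_prod (OneType U B), Nat.card_prod (Fin 3 × TwoType U B),
      Nat.card_prod (Fin 3), card_oneType, Nat.card_fin, ← hn]
    have hn1 : 1 ≤ n := le_add_left Fintype.card_pos
    have h8 : 2 ^ (8 * n) + 1 ≤ 2 ^ (9 * n) := by
      have : 2 ^ (8 * n + 1) ≤ 2 ^ (9 * n) := Nat.pow_le_pow_right (by norm_num) (by omega)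
      have : 1 ≤ 2 ^ (8 * n) := Nat.one_le_two_pow
      omega
    have h4 : 3 ≤ 2 ^ (2 * n) := by
      have : 2 ^ 2 ≤ 2 ^ (2 * n) := Nat.pow_le_pow_right (by norm_num) (by omega)
      omega
    calc 2 ^ n * (3 * Nat.card (TwoType U B) * Nat.card (Option (TwoType U B × TwoType U B)))
        ≤ 2 ^ n * (2 ^ (2 * n) * 2 ^ (4 * n) * 2 ^ (9 * n)) := by
          gcongr
          exact hO.trans h8
      _ = 2 ^ (16 * n) := by ring

/-! ### Cliques as equivalence classes -/

/-- `a` and `b` lie in the same clique. -/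
def Sim (T : B) (𝔄 : Str U B A) (a b : A) : Prop :=
  a = b ∨ (𝔄.bin T a b ∧ 𝔄.bin T b a)

/-- The clique of `a`. -/
def cls (T : B) (𝔄 : Str U B A) (a : A) : Set A := {b | Sim T 𝔄 a b}

theorem Sim.refl (a : A) : Sim T 𝔄 a a := Or.inl rfl

theorem Sim.symm {a b : A} (h : Sim T 𝔄 a b) : Sim T 𝔄 b a :=
  h.elim (fun e => Or.inl e.symm) fun e => Or.inr e.symm

section trans

variable (ht : ∀ a b c : A, 𝔄.bin T a b → 𝔄.bin T b c → 𝔄.bin T a c)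
include ht

theorem Sim.trans {a b c : A} (h : Sim T 𝔄 a b) (h' : Sim T 𝔄 b c) : Sim T 𝔄 a c := by
  rcases h with rfl | ⟨h1, h2⟩
  · exact h'
  rcases h' with rfl | ⟨h3, h4⟩
  · exact Or.inr ⟨h1, h2⟩
  · exact Or.inr ⟨ht _ _ _ h1 h3, ht _ _ _ h4 h2⟩

theorem Sim.bin_of_bin {a b x y : A} (ha : Sim T 𝔄 a x) (hb : Sim T 𝔄 b y)
    (h : 𝔄.bin T a b) : 𝔄.bin T x y := by
  have h1 : 𝔄.bin T x b := by
    rcases ha with rfl | ha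
    · exact h
    · exact ht _ _ _ ha.2 h
  rcases hb with rfl | hb
  · exact h1
  · exact ht _ _ _ h1 hb.1

theorem Sim.bin_iff {a b x y : A} (ha : Sim T 𝔄 a x) (hb : Sim T 𝔄 b y) :
    𝔄.bin T a b ↔ 𝔄.bin T x y :=
  ⟨ha.bin_of_bin ht hb, ha.symm.bin_of_bin ht hb.symm⟩

theorem cls_eq_iff {a b : A} : cls T 𝔄 a = cls T 𝔄 b ↔ Sim T 𝔄 a b := by
  constructor
  · intro h
    have : b ∈ cls T 𝔄 a := h ▸ Sim.refl b
    exact this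
  · intro h
    ext c
    exact ⟨fun h' => h.symm.trans ht h', fun h' => h.trans ht h'⟩

theorem isClique_cls (a : A) : IsClique T 𝔄 (cls T 𝔄 a) := by
  refine ⟨fun x hx y hy hxy => (hx.symm.trans ht hy).resolve_left hxy, fun X hX hsub b hb => ?_⟩
  by_cases e : a = b
  · exact Or.inl e
  · exact Or.inr (hX a (hsub (Sim.refl a)) b hb e)

theorem IsClique.eq_cls {X : Set A} (hX : IsClique T 𝔄 X) {a : A} (ha : a ∈ X) :
    X = cls T 𝔄 a := by
  refine hX.eq_of_subset (isClique_cls ht a).1 fun b hb => ?_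
  by_cases e : a = b
  · exact Or.inl e
  · exact Or.inr (hX.1 a ha b hb e)

end trans

theorem IsClique.nonempty [Nonempty A] {X : Set A} (hX : IsClique T 𝔄 X) : X.Nonempty := by
  by_contra h
  rw [Set.not_nonempty_iff_eq_empty] at h
  let a := Classical.arbitrary A
  have h1 : TConnected T 𝔄 ({a} : Set A) := by
    rintro x rfl y rfl h
    exact absurd rfl h
  have h2 := hX.2 h1 (h ▸ Set.empty_subset _) (Set.mem_singleton a)
  rw [h] at h2
  exact h2

/-! ### Models with small cliques -/

/-- The elements reached from a point by chosen witnesses form a model; addressing them by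
lists of conjuncts puts this model into `Type`. -/
theorem exists_model_type_zero {Ψ : NormalForm U B} (h : Satisfiable.{u, v, w} T Ψ) :
    Satisfiable.{u, v, 0} T Ψ := by
  obtain ⟨A, 𝔄, hA⟩ := h
  choose g hg using hA.gamma
  choose d hd using hA.delta
  obtain ⟨a₀⟩ := hA.nonempty
  let F : List (Fin Ψ.m ⊕ Fin Ψ.m') → A := fun l =>
    l.foldr (fun i a => Sum.elim (fun i => g i a) (fun i => d i a) i) a₀
  let E := Quotient (Setoid.ker F)
  let e : E → A := Quotient.lift F fun _ _ h => h
  have he : Injective e := by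
    intro x y
    exact Quotient.inductionOn₂ x y fun l l' h => Quotient.sound h
  let 𝔅 : Str U B E := ⟨fun p x => 𝔄.un p (e x), fun r x y => 𝔄.bin r (e x) (e y)⟩
  have hφ : ∀ (φ : QF U B) (x y : E), φ.Holds 𝔅 x y ↔ φ.Holds 𝔄 (e x) (e y) :=
    fun φ x y => QF.holds_congr (𝔄 := 𝔅) (𝔅 := 𝔄) (a := x) (b := y) rfl he.eq_iff.symm φ
  refine ⟨E, 𝔅, ⟨Quotient.mk _ []⟩, fun x y z => hA.trans _ _ _,
    fun x y => (hφ _ _ _).2 (hA.univ _ _), ?_, ?_⟩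
  · rintro i ⟨l⟩
    refine ⟨Quotient.mk _ (Sum.inl i :: l), ?_, (hφ _ _ _).2 (hg i (F l)).2⟩
    exact (guard_congr (𝔄 := 𝔅) (𝔅 := 𝔄) rfl T _).2 (hg i (F l)).1
  · rintro i ⟨l⟩
    exact ⟨Quotient.mk _ (Sum.inr i :: l), (hd i (F l)).1, (hφ _ _ _).2 (hd i (F l)).2⟩

/-- The cliques are the fibres that are thinned. The relation `T` does not change, because
2-types between two cliques, or within one, agree on `T`. -/
theorem IsModel.exists_small_cliques [Fintype U] [Fintype B] {Ψ : NormalForm U B}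
    (hA : IsModel T Ψ 𝔄) :
    ∃ (D : Type w) (𝔅 : Str U B D), IsModel T Ψ 𝔅 ∧ ∀ x, (cls T 𝔅 x).encard ≤
      ((2 ^ (16 * (Fintype.card U + Fintype.card B)) : ℕ) : ℕ∞) := by
  have := hA.nonempty
  have : Nonempty B := ⟨T⟩
  have ht := hA.trans
  obtain ⟨D, 𝔅, hne, h1, h2, h3, h4⟩ := exists_thinning 𝔄 (cls T 𝔄)
  have hT : ∀ x y : D, 𝔅.bin T x y ↔ 𝔄.bin T (x : A) y := by
    intro x y
    by_cases hxy : x = y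
    · subst hxy
      exact bin_self_congr (h1 x) T
    · obtain ⟨a, b, -, ha, hb, e⟩ := h2 x y hxy
      rw [(bin_congr e T).1]
      exact Sim.bin_iff ht ((cls_eq_iff ht).1 ha) ((cls_eq_iff ht).1 hb)
  have hS : ∀ x y : D, Sim T 𝔅 x y → Sim T 𝔄 (x : A) y := by
    intro x y h
    simpa only [Sim, hT, Subtype.ext_iff] using h
  refine ⟨D, 𝔅, ⟨hne.to_subtype, ?_, ?_, ?_, ?_⟩, fun x => ?_⟩
  · intro x y z
    simp only [hT]
    exact ht _ _ _
  · intro x y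
    by_cases hxy : x = y
    · subst hxy
      exact (QF.holds_congr (tp₂_self_congr (h1 x)) (by simp) _).2 (hA.univ (x : A) x)
    · obtain ⟨a, b, hab, -, -, e⟩ := h2 x y hxy
      exact (QF.holds_congr e (by simp [hxy, hab]) _).2 (hA.univ a b)
  · intro i x
    obtain ⟨c, hc, hc'⟩ := hA.gamma i x
    obtain ⟨y, hy, e⟩ := h3 x c hc.ne.symm
    exact ⟨y, (guard_congr e T _).2 hc, (QF.holds_congr e (by simp [hc.ne, hy.symm]) _).2 hc'⟩
  · intro i x
    obtain ⟨c, hc, hc'⟩ := hA.delta i x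
    by_cases hcx : c = x
    · subst hcx
      have e := tp₂_self_congr (h1 x)
      exact ⟨x, ⟨(bin_congr e T).1.2 hc.1, (bin_congr e T).2.2 hc.2⟩,
        (QF.holds_congr e (by simp) _).2 hc'⟩
    · obtain ⟨y, hy, e⟩ := h3 x c hcx
      exact ⟨y, ⟨(bin_congr e T).1.2 hc.1, (bin_congr e T).2.2 hc.2⟩,
        (QF.holds_congr e (by simp [Ne.symm hcx, hy.symm]) _).2 hc'⟩
  · refine le_trans ?_ (h4 (cls T 𝔄 x))
    rw [← Subtype.val_injective.encard_image]
    refine Set.encard_le_encard ?_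
    rintro _ ⟨y, hy, rfl⟩
    exact ⟨y.2, ((cls_eq_iff ht).2 (hS x y hy)).symm⟩

/-! ### Profiles -/

/-- The 1-types realized in the clique of an element, and those of the elements below and above
this clique. This is the splice of the clique with the isomorphism type replaced by the set of
1-types. -/
abbrev Profile (U : Type u) (B : Type v) :=
  Set (OneType U B) × Set (OneType U B) × Set (OneType U B)

/-- The profile of the clique of `a`. -/
def prof (T : B) (𝔄 : Str U B A) (a : A) : Profile U B :=
  ({t | ∃ b, Sim T 𝔄 a b ∧ tp 𝔄 b = t},
    {t | ∃ b, tp 𝔄 b = t ∧ 𝔄.bin T b a ∧ ¬ 𝔄.bin T a b},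
    {t | ∃ b, tp 𝔄 b = t ∧ 𝔄.bin T a b ∧ ¬ 𝔄.bin T b a})

/-- Everything in or below a clique of profile `p` has a 1-type that occurs below `q`, and
everything in or above a clique of profile `q` has a 1-type that occurs above `p`. This holds if a
clique of profile `p` lies below one of profile `q`; it is transitive, but not irreflexive. -/
def Prec (p q : Profile U B) : Prop :=
  p.1 ∪ p.2.1 ⊆ q.2.1 ∧ q.1 ∪ q.2.2 ⊆ p.2.2

theorem Prec.trans {p q r : Profile U B} (h : Prec p q) (h' : Prec q r) : Prec p r :=
  ⟨h.1.trans (Set.subset_union_right.trans h'.1), h'.2.trans (Set.subset_union_right.trans h.2)⟩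

/-- The clique of `a` cannot be duplicated: no other clique has its profile, and it may not be
placed below a clique of its own profile. -/
def Royal (T : B) (𝔄 : Str U B A) (a : A) : Prop :=
  ¬ Prec (prof T 𝔄 a) (prof T 𝔄 a) ∧ ∀ b, prof T 𝔄 b = prof T 𝔄 a → Sim T 𝔄 a b

section trans

variable (ht : ∀ a b c : A, 𝔄.bin T a b → 𝔄.bin T b c → 𝔄.bin T a c)
include ht

theorem inTypes_cls (a : A) : InTypes T 𝔄 (cls T 𝔄 a) = (prof T 𝔄 a).2.1 := by
  ext t
  refine exists_congr fun b => and_congr_right fun _ =>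
    ⟨fun h => h a (Sim.refl a), fun h c hc => ?_⟩
  rwa [← Sim.bin_iff ht (Sim.refl b) hc, ← Sim.bin_iff ht hc (Sim.refl b)]

theorem outTypes_cls (a : A) : OutTypes T 𝔄 (cls T 𝔄 a) = (prof T 𝔄 a).2.2 := by
  ext t
  refine exists_congr fun b => and_congr_right fun _ =>
    ⟨fun h => h a (Sim.refl a), fun h c hc => ?_⟩
  rwa [← Sim.bin_iff ht (Sim.refl b) hc, ← Sim.bin_iff ht hc (Sim.refl b)]

theorem Sim.prof_eq {a b : A} (h : Sim T 𝔄 a b) : prof T 𝔄 a = prof T 𝔄 b := by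
  rw [prof, prof, Prod.mk.injEq, Prod.mk.injEq]
  refine ⟨?_, ?_, ?_⟩ <;> ext t
  · exact exists_congr fun c => and_congr_left fun _ =>
      ⟨fun h' => h.symm.trans ht h', fun h' => h.trans ht h'⟩
  · refine exists_congr fun c => and_congr_right fun _ => ?_
    rw [Sim.bin_iff ht (Sim.refl c) h, Sim.bin_iff ht h (Sim.refl c)]
  · refine exists_congr fun c => and_congr_right fun _ => ?_
    rw [Sim.bin_iff ht (Sim.refl c) h, Sim.bin_iff ht h (Sim.refl c)]

theorem prec_of_bin {a b : A} (h : 𝔄.bin T a b) (h' : ¬ 𝔄.bin T b a) :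
    Prec (prof T 𝔄 a) (prof T 𝔄 b) := by
  constructor
  · rintro t (⟨c, hc, e⟩ | ⟨c, e, h1, h2⟩)
    · refine ⟨c, e, ?_⟩
      rwa [← Sim.bin_iff ht hc (Sim.refl b), ← Sim.bin_iff ht (Sim.refl b) hc, and_iff_right h]
    · exact ⟨c, e, ht _ _ _ h1 h, fun h3 => h' (ht _ _ _ h3 h1)⟩
  · rintro t (⟨c, hc, e⟩ | ⟨c, e, h1, h2⟩)
    · refine ⟨c, e, ?_⟩
      rwa [← Sim.bin_iff ht (Sim.refl a) hc, ← Sim.bin_iff ht hc (Sim.refl a), and_iff_right h]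
    · exact ⟨c, e, ht _ _ _ h h1, fun h3 => h' (ht _ _ _ h1 h3)⟩

theorem Royal.of_sim {a b : A} (h : Royal T 𝔄 a) (hab : Sim T 𝔄 a b) : Royal T 𝔄 b := by
  rw [Royal, ← hab.prof_eq ht]
  exact ⟨h.1, fun c hc => hab.symm.trans ht (h.2 c hc)⟩

end trans

theorem Royal.not_prec_symm {a : A} {p : Profile U B} (h : Royal T 𝔄 a)
    (h' : Prec (prof T 𝔄 a) p) : ¬ Prec p (prof T 𝔄 a) :=
  fun h2 => h.1 (h'.trans h2)

/-! ### Structures composed of copies of cliques -/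

section copies

variable {E : Type w} {L : Type*} [LinearOrder L]

/-- The order of the copies `x` and `y` of elements `π x` and `π y`: by the profiles as far as
these decide, otherwise by the positions of the copies. -/
def CopyLt (T : B) (𝔄 : Str U B A) (π : E → A) (pos : E → L) (x y : E) : Prop :=
  Prec (prof T 𝔄 (π x)) (prof T 𝔄 (π y)) ∧
    (¬ Prec (prof T 𝔄 (π y)) (prof T 𝔄 (π x)) ∨ pos x < pos y)

/-- The 2-types that may be given to copies `x` and `y`: the 2-type of `(π x, π y)` inside
a copy of a clique, and otherwise all 2-types realized in `𝔄` that have the right 1-types and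
direction. -/
def CopyTypes (T : B) (𝔄 : Str U B A) (π : E → A) (pos : E → L) (x y : E) :
    Set (TwoType U B) :=
  {τ | (pos x = pos y ∧ τ = tp₂ 𝔄 (π x) (π y)) ∨ (pos x ≠ pos y ∧ ∃ a b, a ≠ b ∧
    tp 𝔄 a = tp 𝔄 (π x) ∧ tp 𝔄 b = tp 𝔄 (π y) ∧ (𝔄.bin T a b ↔ CopyLt T 𝔄 π pos x y) ∧
    (𝔄.bin T b a ↔ CopyLt T 𝔄 π pos y x) ∧ τ = tp₂ 𝔄 a b)}

variable {π : E → A} {pos : E → L}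

theorem CopyLt.asymm {x y : E} (h : CopyLt T 𝔄 π pos x y) : ¬ CopyLt T 𝔄 π pos y x := by
  rintro ⟨h1, h2⟩
  exact lt_asymm (h.2.resolve_left (not_not.2 h1)) (h2.resolve_left (not_not.2 h.1))

theorem CopyLt.trans {x y z : E} (h : CopyLt T 𝔄 π pos x y) (h' : CopyLt T 𝔄 π pos y z) :
    CopyLt T 𝔄 π pos x z := by
  refine ⟨h.1.trans h'.1, or_iff_not_imp_left.2 fun h3 => ?_⟩
  rw [not_not] at h3
  exact lt_trans (h.2.resolve_left (not_not.2 (h'.1.trans h3)))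
    (h'.2.resolve_left (not_not.2 (h3.trans h.1)))

variable (ht : ∀ a b c : A, 𝔄.bin T a b → 𝔄.bin T b c → 𝔄.bin T a c)
include ht

/-- The only case that uses the absence of royal elements is that of two copies of one clique
whose profile does not precede itself: then another clique of the same profile exists, and is
incomparable. -/
theorem copyTypes_nonempty
    (hroyal : ∀ x y, pos x ≠ pos y → Sim T 𝔄 (π x) (π y) → ¬ Royal T 𝔄 (π x)) (x y : E) :
    (CopyTypes T 𝔄 π pos x y).Nonempty := by
  by_cases e : pos x = pos y
  · exact ⟨_, Or.inl ⟨e, rfl⟩⟩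
  suffices h : ∃ a b, a ≠ b ∧
      tp 𝔄 a = tp 𝔄 (π x) ∧ tp 𝔄 b = tp 𝔄 (π y) ∧ (𝔄.bin T a b ↔ CopyLt T 𝔄 π pos x y) ∧
      (𝔄.bin T b a ↔ CopyLt T 𝔄 π pos y x) by
    obtain ⟨a, b, h1, h2, h3, h4, h5⟩ := h
    exact ⟨_, Or.inr ⟨e, a, b, h1, h2, h3, h4, h5, rfl⟩⟩
  have ne_of : ∀ {a b : A}, 𝔄.bin T a b → ¬ 𝔄.bin T b a → a ≠ b := by
    rintro a b h h' rfl
    exact h' h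
  by_cases h1 : CopyLt T 𝔄 π pos x y
  · obtain ⟨b, hb, h2, h3⟩ : tp 𝔄 (π y) ∈ (prof T 𝔄 (π x)).2.2 :=
      h1.1.2 (Or.inl ⟨π y, Sim.refl _, rfl⟩)
    exact ⟨π x, b, ne_of h2 h3, rfl, hb, iff_of_true h2 h1, iff_of_false h3 h1.asymm⟩
  by_cases h2 : CopyLt T 𝔄 π pos y x
  · obtain ⟨a, ha, h3, h4⟩ : tp 𝔄 (π x) ∈ (prof T 𝔄 (π y)).2.2 :=
      h2.1.2 (Or.inl ⟨π x, Sim.refl _, rfl⟩)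
    exact ⟨a, π y, (ne_of h3 h4).symm, ha, rfl, iff_of_false h4 h1, iff_of_true h3 h2⟩
  -- Neither profile precedes the other, so that unequal cliques of these profiles are incomparable.
  have h3 : ¬ Prec (prof T 𝔄 (π x)) (prof T 𝔄 (π y)) ∧
      ¬ Prec (prof T 𝔄 (π y)) (prof T 𝔄 (π x)) := by
    simp only [CopyLt] at h1 h2
    rcases lt_or_gt_of_ne e with h | h <;> tauto
  suffices h : ∃ b, tp 𝔄 b = tp 𝔄 (π y) ∧ prof T 𝔄 b = prof T 𝔄 (π y) ∧ ¬ Sim T 𝔄 (π x) b by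
    obtain ⟨b, hb, hp, hS⟩ := h
    rw [← hp] at h3
    simp only [Sim, not_or, not_and] at hS
    have h4 : ¬ 𝔄.bin T (π x) b := fun h => h3.1 (prec_of_bin ht h (hS.2 h))
    have h5 : ¬ 𝔄.bin T b (π x) := fun h => h3.2 (prec_of_bin ht h fun h' => hS.2 h' h)
    exact ⟨π x, b, hS.1, rfl, hb, iff_of_false h4 h1, iff_of_false h5 h2⟩
  by_cases hS : Sim T 𝔄 (π x) (π y)
  · have hr := hroyal x y e hS
    rw [hS.prof_eq ht] at h3
    simp only [Royal, not_and, not_forall] at hr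
    rw [hS.prof_eq ht] at hr
    obtain ⟨b, hb, hb'⟩ := hr h3.1
    obtain ⟨c, hc, hc'⟩ : tp 𝔄 (π y) ∈ (prof T 𝔄 b).1 := by
      rw [hb]
      exact ⟨π y, Sim.refl _, rfl⟩
    exact ⟨c, hc', by rw [← hc.prof_eq ht, hb], fun h => hb' (h.trans ht hc.symm)⟩
  · exact ⟨π y, rfl, rfl, hS⟩

variable (hsim : ∀ x y, pos x = pos y → Sim T 𝔄 (π x) (π y))
include hsim

theorem CopyLt.pos_ne {x y : E} (h : CopyLt T 𝔄 π pos x y) : pos x ≠ pos y := by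
  intro e
  have := (hsim x y e).prof_eq ht
  rcases h with ⟨h1, h2 | h2⟩
  · rw [this] at h1 h2
    exact h2 h1
  · exact h2.ne e

/-- The structure on a set `E` of copies of elements of `𝔄`. Elements of equal position form
the copy of a clique; royal cliques must not be copied more than once. -/
theorem exists_copy_str {M : Type*} [LinearOrder M] (key : E → M) (hkey : Injective key)
    (hinj : ∀ x y, pos x = pos y → π x = π y → x = y)
    (hroyal : ∀ x y, pos x ≠ pos y → Sim T 𝔄 (π x) (π y) → ¬ Royal T 𝔄 (π x))
    (Want : E → E → Set (TwoType U B))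
    (want_ok : ∀ x y, Want x y ⊆ CopyTypes T 𝔄 π pos x y)
    (want_unique : ∀ x y, ∀ τ ∈ Want x y, ∀ τ' ∈ Want x y, τ = τ')
    (want_flip : ∀ x y, ∀ τ ∈ Want x y, ∀ τ' ∈ Want y x, τ' = flipType τ) :
    ∃ 𝔅 : Str U B E, (∀ x, tp 𝔅 x = tp 𝔄 (π x)) ∧
      (∀ x y, 𝔅.bin T x y ↔
        (pos x = pos y ∧ 𝔄.bin T (π x) (π y)) ∨ CopyLt T 𝔄 π pos x y) ∧
      (∀ x y, pos x = pos y → tp₂ 𝔅 x y = tp₂ 𝔄 (π x) (π y)) ∧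
      (∀ x y, x ≠ y → ∃ a b, a ≠ b ∧ tp₂ 𝔅 x y = tp₂ 𝔄 a b) ∧
      (∀ x y, x ≠ y → ∀ τ ∈ Want x y, tp₂ 𝔅 x y = τ) ∧
      ∀ x y x' y', x ≠ y → x' ≠ y' → (key x < key y ↔ key x' < key y') →
        π x = π x' → π y = π y' → (pos x < pos y ↔ pos x' < pos y') →
        (pos y < pos x ↔ pos y' < pos x') → Want x y = Want x' y' →
        Want y x = Want y' x' → tp₂ 𝔅 x y = tp₂ 𝔅 x' y' := by
  obtain ⟨𝔅, h1, h2, h3, h4⟩ := exists_str_of_types key hkey (fun x => tp 𝔄 (π x))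
    (CopyTypes T 𝔄 π pos) Want
    (by
      rintro x y τ (⟨-, rfl⟩ | ⟨-, a, b, -, ha, hb, -, -, rfl⟩)
      · exact ⟨rfl, rfl⟩
      · exact ⟨ha, hb⟩)
    (by
      rintro x y τ (⟨e, rfl⟩ | ⟨e, a, b, hab, ha, hb, h, h', rfl⟩)
      · exact Or.inl ⟨e.symm, rfl⟩
      · exact Or.inr ⟨Ne.symm e, b, a, hab.symm, hb, ha, h', h, rfl⟩)
    (fun x y _ => copyTypes_nonempty ht hroyal x y)
    (fun x y _ => want_ok x y) want_unique (fun x y _ => want_flip x y)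
  have h5 : ∀ x y, pos x = pos y → tp₂ 𝔅 x y = tp₂ 𝔄 (π x) (π y) := by
    intro x y e
    by_cases hxy : x = y
    · subst hxy
      exact tp₂_self_congr (h1 x)
    · exact (h2 x y hxy).elim (fun h => h.2) fun h => absurd e h.1
  refine ⟨𝔅, h1, ?_, h5, ?_, h3, ?_⟩
  · intro x y
    by_cases e : pos x = pos y
    · rw [(bin_congr (h5 x y e) T).1]
      exact ⟨fun h => Or.inl ⟨e, h⟩,
        fun h => h.elim And.right fun h => absurd e (h.pos_ne ht hsim)⟩
    · rcases h2 x y (fun h => e (congrArg pos h)) with h | ⟨-, a, b, -, -, -, h, -, h'⟩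
      · exact absurd h.1 e
      · rw [(bin_congr h' T).1, h]
        exact ⟨Or.inr, fun h => h.resolve_left fun h => e h.1⟩
  · intro x y hxy
    rcases h2 x y hxy with ⟨e, h⟩ | ⟨-, a, b, hab, -, -, -, -, h⟩
    · exact ⟨_, _, fun h => hxy (hinj x y e h), h⟩
    · exact ⟨a, b, hab, h⟩
  · intro x y x' y' hxy hxy' hk hx hy hlt hgt hw hw'
    have he : pos x = pos y ↔ pos x' = pos y' := by
      rw [← not_iff_not, ← ne_eq, ← ne_eq, ne_iff_lt_or_gt, ne_iff_lt_or_gt, hlt, hgt]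
    have e1 : CopyLt T 𝔄 π pos x y = CopyLt T 𝔄 π pos x' y' := by
      simp only [CopyLt, hx, hy, hlt]
    have e2 : CopyLt T 𝔄 π pos y x = CopyLt T 𝔄 π pos y' x' := by
      simp only [CopyLt, hx, hy, hgt]
    refine h4 x y x' y' hxy hxy' hk ?_ ?_ hw hw'
    · simp only [CopyTypes, hx, hy, he, e1, e2, ne_eq]
    · simp only [CopyTypes, hx, hy, eq_comm (a := pos y), eq_comm (a := pos y'), he, e1, e2,
        ne_eq]

end copies

/-! ### Layers of copies -/

/-- The universe of the regular model: the elements of `S₀`, and at each later level a copy of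
`S₁` for each index `i : I`. -/
abbrev Copies (I : Type) (S₀ S₁ : Set A) := S₀ ⊕ (ℕ × I × S₁)

namespace Copies

variable {I : Type} {S₀ S₁ : Set A}

/-- The element of which `x` is a copy. -/
def val : Copies I S₀ S₁ → A
  | .inl a => a
  | .inr x => x.2.2

/-- The number of the layer. -/
def lev : Copies I S₀ S₁ → ℕ
  | .inl _ => 0
  | .inr x => x.1 + 1

/-- The index of the copy of `S₁`, if `x` is not in layer `0`. -/
def tag : Copies I S₀ S₁ → Option I
  | .inl _ => none
  | .inr x => some x.2.1

/-- All data of `x` but its level. -/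
def core : Copies I S₀ S₁ → S₀ ⊕ (I × S₁)
  | .inl a => .inl a
  | .inr x => .inr x.2

/-- The level with a sign: copies with `up i` are placed above everything of lower level, the
other copies below it. -/
def height (up : I → Bool) : Copies I S₀ S₁ → ℤ
  | .inl _ => 0
  | .inr x => if up x.2.1 then x.1 + 1 else -(x.1 + 1)

/-- The position of the clique of `x` in a linear order of all copies of cliques. Ties between
cliques of equal height are broken arbitrarily. -/
noncomputable def pos (T : B) (𝔄 : Str U B A) (up : I → Bool) (x : Copies I S₀ S₁) :
    ℤ ×ₗ Cardinal.{w} :=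
  toLex (height up x, embeddingToCardinal (tag x, cls T 𝔄 (val x)))

/-- An injection into a linear order that compares levels first. -/
noncomputable def key (x : Copies I S₀ S₁) : ℕ ×ₗ Cardinal.{w} :=
  toLex (lev x, embeddingToCardinal (core x))

theorem ext_iff {x y : Copies I S₀ S₁} : x = y ↔ lev x = lev y ∧ core x = core y := by
  rcases x with a | ⟨k, i, a⟩ <;> rcases y with b | ⟨l, j, b⟩ <;> simp [lev, core]

theorem key_injective : Injective (key : Copies I S₀ S₁ → _) := by
  intro x y h
  simp only [key, EmbeddingLike.apply_eq_iff_eq, Prod.mk.injEq] at h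
  exact ext_iff.2 h

theorem val_eq_of_core_eq {x y : Copies I S₀ S₁} (h : core x = core y) : val x = val y := by
  rcases x with a | ⟨k, i, a⟩ <;> rcases y with b | ⟨l, j, b⟩ <;>
    simp_all [val, core]

theorem tag_eq_of_core_eq {x y : Copies I S₀ S₁} (h : core x = core y) : tag x = tag y := by
  rcases x with a | ⟨k, i, a⟩ <;> rcases y with b | ⟨l, j, b⟩ <;>
    simp_all [tag, core]

variable {up : I → Bool}

theorem natAbs_height (x : Copies I S₀ S₁) : (height up x).natAbs = lev x := by
  rcases x with a | ⟨k, i, a⟩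
  · rfl
  · simp only [height, lev]
    split_ifs <;> omega

theorem height_of_tag {x : Copies I S₀ S₁} {i : I} (h : tag x = some i) :
    height up x = if up i then (lev x : ℤ) else -lev x := by
  rcases x with a | ⟨k, j, a⟩
  · simp [tag] at h
  · simp only [tag, Option.some.injEq] at h
    subst h
    simp [height, lev]

theorem pos_eq_iff {x y : Copies I S₀ S₁} : pos T 𝔄 up x = pos T 𝔄 up y ↔
    height up x = height up y ∧ tag x = tag y ∧ cls T 𝔄 (val x) = cls T 𝔄 (val y) := by
  simp [pos]

theorem pos_lt_of_height_lt {x y : Copies I S₀ S₁} (h : height up x < height up y) :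
    pos T 𝔄 up x < pos T 𝔄 up y :=
  Prod.Lex.toLex_lt_toLex.2 (Or.inl h)

theorem pos_lt_of_tag {x y : Copies I S₀ S₁} {i : I} (h : lev x < lev y) (hi : tag y = some i) :
    (up i = true → pos T 𝔄 up x < pos T 𝔄 up y) ∧
      (up i = false → pos T 𝔄 up y < pos T 𝔄 up x) := by
  have h1 := natAbs_height (up := up) x
  have h2 := height_of_tag (up := up) hi
  constructor <;> intro e <;> refine pos_lt_of_height_lt ?_ <;> simp [e] at h2 <;> omega

theorem lev_eq_of_pos_eq {x y : Copies I S₀ S₁} (h : pos T 𝔄 up x = pos T 𝔄 up y) :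
    lev x = lev y := by
  rw [← natAbs_height (up := up) x, ← natAbs_height (up := up) y, (pos_eq_iff.1 h).1]

theorem eq_of_pos_eq {x y : Copies I S₀ S₁} (h : pos T 𝔄 up x = pos T 𝔄 up y)
    (h' : val x = val y) : x = y := by
  have h1 := lev_eq_of_pos_eq h
  have h2 := (pos_eq_iff.1 h).2.1
  rcases x with a | ⟨k, i, a⟩ <;> rcases y with b | ⟨l, j, b⟩ <;>
    simp_all [lev, tag, val, Subtype.ext_iff]

theorem height_lt_congr {x y x' y' : Copies I S₀ S₁} (hx : core x = core x')
    (hy : core y = core y') (h : lev x < lev y ↔ lev x' < lev y')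
    (h' : lev y < lev x ↔ lev y' < lev x') :
    height up x < height up y ↔ height up x' < height up y' := by
  rcases x with a | ⟨k, i, a⟩ <;> rcases x' with a' | ⟨k', i', a'⟩ <;>
    rcases y with b | ⟨l, j, b⟩ <;> rcases y' with b' | ⟨l', j', b'⟩ <;>
    simp only [core, reduceCtorEq, Sum.inr.injEq, Prod.mk.injEq] at hx hy
  · simp [height]
  · obtain ⟨rfl, -⟩ := hy
    simp only [height]
    split_ifs <;> omega
  · obtain ⟨rfl, -⟩ := hx
    simp only [height]
    split_ifs <;> omega
  · obtain ⟨rfl, -⟩ := hx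
    obtain ⟨rfl, -⟩ := hy
    simp only [lev] at h h'
    simp only [height]
    split_ifs <;> omega

theorem pos_lt_congr {x y x' y' : Copies I S₀ S₁} (hx : core x = core x')
    (hy : core y = core y') (h : lev x < lev y ↔ lev x' < lev y')
    (h' : lev y < lev x ↔ lev y' < lev x') :
    pos T 𝔄 up x < pos T 𝔄 up y ↔ pos T 𝔄 up x' < pos T 𝔄 up y' := by
  have h1 := height_lt_congr (up := up) hx hy h h'
  have h2 := height_lt_congr (up := up) hy hx h' h
  have h3 : height up x = height up y ↔ height up x' = height up y' := by
    rw [← not_iff_not, ← ne_eq, ← ne_eq, ne_iff_lt_or_gt, ne_iff_lt_or_gt, h1, h2]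
  simp only [pos, Prod.Lex.toLex_lt_toLex, h1, h3, val_eq_of_core_eq hx, val_eq_of_core_eq hy,
    tag_eq_of_core_eq hx, tag_eq_of_core_eq hy]

theorem key_lt_congr {x y x' y' : Copies I S₀ S₁} (hx : core x = core x')
    (hy : core y = core y') (h : lev x < lev y ↔ lev x' < lev y')
    (h' : lev y < lev x ↔ lev y' < lev x') :
    key x < key y ↔ key x' < key y' := by
  have h3 : lev x = lev y ↔ lev x' = lev y' := by omega
  simp only [key, Prod.Lex.toLex_lt_toLex, h, h3, hx, hy]

end Copies

open Copies

/-- The direction of the copies that serve as witnesses of a conjunct. -/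
def Dir.isUp : Dir → Bool
  | .right => true
  | .left => false

/-- The properties of the layered structure composed of copies of cliques of `𝔄`: it is a model
with the same profiles; every witness requirement is met in layer `0`, or else in
all layers above the given element; 2-types depend on the levels through their order only; and
royal cliques occur only once. -/
structure IsLayered (T : B) (Ψ : NormalForm U B) (𝔄 : Str U B A) (h : ℕ) {I : Type}
    {S₀ S₁ : Set A} (𝔅 : Str U B (Copies I S₀ S₁)) : Prop where
  isModel : IsModel T Ψ 𝔅
  lev_eq : ∀ x y, Sim T 𝔅 x y → lev x = lev y
  clique_le : ∀ x, (cls T 𝔅 x).encard ≤ (h : ℕ∞)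
  prof_eq : ∀ x, prof T 𝔅 x = prof T 𝔄 (val x)
  witness : ∀ x i, (∃ y ∈ Wit T Ψ 𝔅 i x, lev y = 0) ∨
    ∀ k, lev x ≤ k → ∃ y ∈ Wit T Ψ 𝔅 i x, lev y = k + 1
  tp₂_congr : ∀ x y x' y', core x = core x' → core y = core y' →
    (lev x < lev y ↔ lev x' < lev y') → (lev y < lev x ↔ lev y' < lev x') →
    tp₂ 𝔅 x y = tp₂ 𝔅 x' y'
  sim_of_royal : ∀ x y, Royal T 𝔄 (val x) → prof T 𝔅 y = prof T 𝔅 x → Sim T 𝔅 x y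

theorem iff_copyLt_of_guard {E : Type w} {L : Type*} [LinearOrder L] {π : E → A} {pos : E → L}
    (ht : ∀ a b c : A, 𝔄.bin T a b → 𝔄.bin T b c → 𝔄.bin T a c) {d : Dir} {a b : A} {x y : E}
    (hg : d.Guard T 𝔄 a b) (hx : prof T 𝔄 (π x) = prof T 𝔄 a)
    (hy : prof T 𝔄 (π y) = prof T 𝔄 b)
    (h : (Royal T 𝔄 a ∨ Royal T 𝔄 b) ∨
      ((d.isUp = true → pos x < pos y) ∧ (d.isUp = false → pos y < pos x))) :
    (𝔄.bin T a b ↔ CopyLt T 𝔄 π pos x y) ∧ (𝔄.bin T b a ↔ CopyLt T 𝔄 π pos y x) := by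
  cases d with
  | right =>
    have hp := prec_of_bin ht hg.1 hg.2
    have h1 : CopyLt T 𝔄 π pos x y := by
      rw [CopyLt, hx, hy]
      refine ⟨hp, ?_⟩
      rcases h with (h | h) | h
      · exact Or.inl (h.not_prec_symm hp)
      · exact Or.inl fun h' => h.not_prec_symm h' hp
      · exact Or.inr (h.1 rfl)
    exact ⟨iff_of_true hg.1 h1, iff_of_false hg.2 h1.asymm⟩
  | left =>
    have hp := prec_of_bin ht hg.2 hg.1
    have h1 : CopyLt T 𝔄 π pos y x := by
      rw [CopyLt, hx, hy]
      refine ⟨hp, ?_⟩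
      rcases h with (h | h) | h
      · exact Or.inl fun h' => h.not_prec_symm h' hp
      · exact Or.inl (h.not_prec_symm hp)
      · exact Or.inr (h.2 rfl)
    exact ⟨iff_of_false hg.1 h1.asymm, iff_of_true hg.2 h1⟩

/-- The layered structure. Two kinds of pairs receive a prescribed 2-type. A pair with a royal
element keeps its 2-type from `𝔄`, if this fits the order; since a royal clique is comparable to
every other one in at most one direction, all witnesses that are royal, or required by
royal elements, are preserved. If `x` and its `i`-th witness are not royal, then a copy with
index `i` of an element with the profile and 1-type of the witness takes over, in all
later layers. -/
theorem IsModel.exists_isLayered {Ψ : NormalForm U B} {h : ℕ} (hA : IsModel T Ψ 𝔄)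
    (hh : ∀ a, (cls T 𝔄 a).encard ≤ (h : ℕ∞)) {g : Fin Ψ.m → A → A}
    (hg : ∀ i a, (Ψ.dir i).Guard T 𝔄 a (g i a) ∧ (Ψ.gamma i).Holds 𝔄 a (g i a))
    {S₀ S₁ : Set A} (hne : S₀.Nonempty) (h₀ : ∀ a b, Sim T 𝔄 a b → a ∈ S₀ → b ∈ S₀)
    (h₁ : ∀ a b, Sim T 𝔄 a b → a ∈ S₁ → b ∈ S₁) (hr₀ : ∀ a, Royal T 𝔄 a → a ∈ S₀)
    (hr₁ : ∀ a, a ∈ S₁ → ¬ Royal T 𝔄 a) (hgr : ∀ i a, Royal T 𝔄 a → g i a ∈ S₀)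
    (hrep : ∀ a, ¬ Royal T 𝔄 a → ∃ b ∈ S₁, prof T 𝔄 b = prof T 𝔄 a ∧ tp 𝔄 b = tp 𝔄 a) :
    ∃ 𝔅 : Str U B (Copies (Fin Ψ.m ⊕ Bool) S₀ S₁), IsLayered T Ψ 𝔄 h 𝔅 := by
  classical
  have ht := hA.trans
  choose! rep rep_mem rep_prof rep_tp using hrep
  let up : Fin Ψ.m ⊕ Bool → Bool := Sum.elim (fun i => (Ψ.dir i).isUp) id
  let E := Copies (Fin Ψ.m ⊕ Bool) S₀ S₁
  let p : E → ℤ ×ₗ Cardinal := Copies.pos T 𝔄 up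
  have hsim : ∀ x y : E, p x = p y → Sim T 𝔄 (val x) (val y) := fun x y e =>
    (cls_eq_iff ht).1 (pos_eq_iff.1 e).2.2
  have not_royal : ∀ x : E, lev x ≠ 0 → ¬ Royal T 𝔄 (val x) := by
    rintro (a | ⟨k, i, a⟩) hx
    · exact absurd rfl hx
    · exact hr₁ _ a.2
  have hroyal : ∀ x y : E, p x ≠ p y → Sim T 𝔄 (val x) (val y) → ¬ Royal T 𝔄 (val x) := by
    intro x y hp hS hR
    have hx : lev x = 0 := by_contra fun hx => not_royal x hx hR
    have hy : lev y = 0 := by_contra fun hy => not_royal y hy (hR.of_sim ht hS)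
    refine hp (pos_eq_iff.2 ⟨?_, ?_, (cls_eq_iff ht).2 hS⟩) <;>
      rcases x with a | ⟨k, i, a⟩ <;> rcases y with b | ⟨l, j, b⟩ <;>
      first | rfl | simp [lev] at hx hy
  have full : ∀ (x : E) a, Sim T 𝔄 (val x) a → ∃ y : E, p y = p x ∧ val y = a := by
    rintro (a | ⟨k, i, a⟩) b hS
    · exact ⟨.inl ⟨b, h₀ _ _ hS a.2⟩, pos_eq_iff.2 ⟨rfl, rfl, ((cls_eq_iff ht).2 hS).symm⟩, rfl⟩
    · exact ⟨.inr ⟨k, i, ⟨b, h₁ _ _ hS a.2⟩⟩,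
        pos_eq_iff.2 ⟨rfl, rfl, ((cls_eq_iff ht).2 hS).symm⟩, rfl⟩
  let Lt : E → E → Prop := CopyLt T 𝔄 val p
  let Want : E → E → Set (TwoType U B) := fun x y =>
    {τ | ((Royal T 𝔄 (val x) ∨ Royal T 𝔄 (val y)) ∧ p x ≠ p y ∧
        (𝔄.bin T (val x) (val y) ↔ Lt x y) ∧ (𝔄.bin T (val y) (val x) ↔ Lt y x) ∧
        τ = tp₂ 𝔄 (val x) (val y)) ∨
      (¬ (Royal T 𝔄 (val x) ∨ Royal T 𝔄 (val y)) ∧ lev x < lev y ∧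
        ∃ i, ¬ Royal T 𝔄 (g i (val x)) ∧ tag y = some (.inl i) ∧ val y = rep (g i (val x)) ∧
          τ = tp₂ 𝔄 (val x) (g i (val x)))}
  have want_ok : ∀ x y, Want x y ⊆ CopyTypes T 𝔄 val p x y := by
    rintro x y τ (⟨hR, hp, h1, h2, rfl⟩ | ⟨-, hlt, i, hi, hy, e, rfl⟩)
    · refine Or.inr ⟨hp, _, _, fun e => ?_, rfl, rfl, h1, h2, rfl⟩
      rcases hR with hR | hR
      · exact hroyal x y hp (Or.inl e) hR
      · exact hroyal y x hp.symm (Or.inl e.symm) hR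
    · have h1 := pos_lt_of_tag (T := T) (𝔄 := 𝔄) (up := up) hlt hy
      have h2 := iff_copyLt_of_guard (π := val) (pos := p) (x := x) (y := y) ht (hg i (val x)).1
        rfl (by rw [e, rep_prof _ hi]) (Or.inr h1)
      refine Or.inr ⟨fun e' => hlt.ne (lev_eq_of_pos_eq e'), _, _, (hg i (val x)).1.ne, rfl, ?_,
        h2.1, h2.2, rfl⟩
      rw [e, rep_tp _ hi]
  have want_unique : ∀ x y, ∀ τ ∈ Want x y, ∀ τ' ∈ Want x y, τ = τ' := by
    rintro x y τ (⟨hR, -, -, -, rfl⟩ | ⟨hR, -, i, -, hy, -, rfl⟩) τ'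
      (⟨hR', -, -, -, rfl⟩ | ⟨hR', -, i', -, hy', -, rfl⟩)
    · rfl
    · exact absurd hR hR'
    · exact absurd hR' hR
    · rw [hy, Option.some.injEq, Sum.inl.injEq] at hy'
      rw [hy']
  have want_flip : ∀ x y, ∀ τ ∈ Want x y, ∀ τ' ∈ Want y x, τ' = flipType τ := by
    rintro x y τ (⟨hR, -, -, -, rfl⟩ | ⟨hR, hlt, -⟩) τ'
      (⟨hR', -, -, -, rfl⟩ | ⟨hR', hlt', -⟩)
    · rfl
    · exact absurd hR.symm hR'
    · exact absurd hR'.symm hR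
    · exact absurd hlt hlt'.asymm
  obtain ⟨𝔅, tp_eq, bin_iff, tp₂_eq, old, want, symm⟩ := exists_copy_str ht hsim key key_injective
    (fun x y => eq_of_pos_eq) hroyal Want want_ok want_unique want_flip
  have simB : ∀ x y, Sim T 𝔅 x y ↔ p x = p y := by
    intro x y
    constructor
    · rintro (rfl | ⟨h1, h2⟩)
      · rfl
      · rcases (bin_iff x y).1 h1 with h1 | h1
        · exact h1.1
        · rcases (bin_iff y x).1 h2 with h2 | h2
          · exact h2.1.symm
          · exact absurd h2 h1.asymm
    · intro e
      rcases hsim x y e with h1 | h1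
      · exact Or.inl (eq_of_pos_eq e h1)
      · exact Or.inr ⟨(bin_iff x y).2 (Or.inl ⟨e, h1.1⟩),
          (bin_iff y x).2 (Or.inl ⟨e.symm, h1.2⟩)⟩
  have ltB : ∀ x y, (𝔅.bin T x y ∧ ¬ 𝔅.bin T y x) ↔ Lt x y := by
    intro x y
    constructor
    · rintro ⟨h1, h2⟩
      refine ((bin_iff x y).1 h1).resolve_left fun h3 => ?_
      rcases (simB x y).2 h3.1 with rfl | h4
      · exact h2 h1
      · exact h2 h4.2
    · intro h1
      refine ⟨(bin_iff x y).2 (Or.inr h1), fun h2 => ?_⟩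
      rcases (bin_iff y x).1 h2 with h2 | h2
      · exact h1.pos_ne ht hsim h2.1.symm
      · exact h1.asymm h2
  have trB : ∀ x y z, 𝔅.bin T x y → 𝔅.bin T y z → 𝔅.bin T x z := by
    have congr : ∀ {x y x' y' : E}, p x = p x' → p y = p y' → Lt x y → Lt x' y' := by
      intro x y x' y' hx hy
      simp only [Lt, CopyLt, hx, hy, (hsim _ _ hx).prof_eq ht, (hsim _ _ hy).prof_eq ht, imp_self]
    intro x y z h1 h2
    rw [bin_iff] at h1 h2 ⊢
    rcases h1 with ⟨e1, h1⟩ | h1 <;> rcases h2 with ⟨e2, h2⟩ | h2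
    · exact Or.inl ⟨e1.trans e2, ht _ _ _ h1 h2⟩
    · exact Or.inr (congr e1.symm rfl h2)
    · exact Or.inr (congr rfl e2 h1)
    · exact Or.inr (h1.trans h2)
  have wit_of_tp₂ : ∀ {x y : E} {i}, x ≠ y → tp₂ 𝔅 x y = tp₂ 𝔄 (val x) (g i (val x)) →
      y ∈ Wit T Ψ 𝔅 i x := fun {x y i} hxy e =>
    ⟨⟨(guard_congr e T _).2 (hg i _).1,
      (QF.holds_congr e (by simp [hxy, (hg i (val x)).1.ne]) _).2 (hg i _).2⟩, hxy⟩
  have witness : ∀ (x : E) i, (∃ y ∈ Wit T Ψ 𝔅 i x, lev y = 0) ∨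
      ∀ k, lev x ≤ k → ∃ y ∈ Wit T Ψ 𝔅 i x, lev y = k + 1 := by
    intro x i
    by_cases hR : Royal T 𝔄 (val x) ∨ Royal T 𝔄 (g i (val x))
    · have hmem : g i (val x) ∈ S₀ := hR.elim (hgr i _) (hr₀ _)
      let y : E := .inl ⟨g i (val x), hmem⟩
      have h1 := iff_copyLt_of_guard (π := val) (pos := p) (x := x) (y := y) ht (hg i (val x)).1
        rfl rfl (Or.inl hR)
      have hp : p x ≠ p y := by
        have h2 := (hg i (val x)).1
        revert h2
        cases Ψ.dir i
        · exact fun h2 => (h1.1.1 h2.1).pos_ne ht hsim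
        · exact fun h2 => ((h1.2.1 h2.2).pos_ne ht hsim).symm
      have hxy : x ≠ y := fun e => hp (congrArg p e)
      exact Or.inl ⟨y, wit_of_tp₂ hxy (want x y hxy _ (Or.inl ⟨hR, hp, h1.1, h1.2, rfl⟩)), rfl⟩
    · rw [not_or] at hR
      refine Or.inr fun k hk => ?_
      let y : E := .inr ⟨k, .inl i, ⟨_, rep_mem _ hR.2⟩⟩
      have hxy : x ≠ y := by
        intro e
        have h1 : lev x = lev y := congrArg lev e
        have h2 : lev y = k + 1 := rfl
        omega
      refine ⟨y, wit_of_tp₂ hxy (want x y hxy _ (Or.inr ⟨?_, Nat.lt_succ_of_le hk, i, hR.2, rfl,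
        rfl, rfl⟩)), rfl⟩
      exact not_or.2 ⟨hR.1, not_royal y (Nat.succ_ne_zero k)⟩
  have prof_eq : ∀ x, prof T 𝔅 x = prof T 𝔄 (val x) := by
    -- Some copy of every element is placed above, and some copy below, a given element, unless
    -- the element is royal and its clique is comparable in one direction only.
    have copy : ∀ (b : Bool) (x : E) (a : A), ∃ y : E, prof T 𝔄 (val y) = prof T 𝔄 a ∧
        tp 𝔄 (val y) = tp 𝔄 a ∧ (Royal T 𝔄 a ∨
          ((b = true → p x < p y) ∧ (b = false → p y < p x))) := by
      intro b x a
      by_cases hR : Royal T 𝔄 a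
      · exact ⟨.inl ⟨a, hr₀ a hR⟩, rfl, rfl, Or.inl hR⟩
      · let y : E := .inr ⟨lev x, .inr b, ⟨_, rep_mem a hR⟩⟩
        have h1 : lev x < lev y := Nat.lt_succ_self _
        have h2 : tag y = some (.inr b) := rfl
        exact ⟨y, rep_prof a hR, rep_tp a hR, Or.inr (pos_lt_of_tag (up := up) h1 h2)⟩
    intro x
    rw [prof, prof, Prod.mk.injEq, Prod.mk.injEq]
    refine ⟨?_, ?_, ?_⟩ <;> ext t
    · constructor
      · rintro ⟨y, hy, rfl⟩
        exact ⟨val y, hsim x y ((simB x y).1 hy), (tp_eq y).symm⟩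
      · rintro ⟨b, hb, rfl⟩
        obtain ⟨y, hy, rfl⟩ := full x b hb
        exact ⟨y, (simB x y).2 hy.symm, tp_eq y⟩
    · constructor
      · rintro ⟨y, rfl, hy⟩
        rw [tp_eq]
        exact ((ltB y x).1 hy).1.1 (Or.inl ⟨val y, Sim.refl _, rfl⟩)
      · rintro ⟨b, rfl, hb, hb'⟩
        obtain ⟨y, h1, h2, h3⟩ := copy false x b
        refine ⟨y, (tp_eq y).trans h2, (ltB y x).2 ?_⟩
        refine (iff_copyLt_of_guard ht (d := .left) ⟨hb', hb⟩ rfl h1 ?_).2.1 hb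
        exact h3.imp Or.inr id
    · constructor
      · rintro ⟨y, rfl, hy⟩
        rw [tp_eq]
        exact ((ltB x y).1 hy).1.2 (Or.inl ⟨val y, Sim.refl _, rfl⟩)
      · rintro ⟨b, rfl, hb, hb'⟩
        obtain ⟨y, h1, h2, h3⟩ := copy true x b
        refine ⟨y, (tp_eq y).trans h2, (ltB x y).2 ?_⟩
        refine (iff_copyLt_of_guard ht (d := .right) ⟨hb, hb'⟩ rfl h1 ?_).1.1 hb
        exact h3.imp Or.inr id
  refine ⟨𝔅, ⟨⟨⟨.inl ⟨_, hne.some_mem⟩⟩, trB, ?_, ?_, ?_⟩, ?_, ?_, prof_eq, witness, ?_, ?_⟩⟩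
  · intro x y
    by_cases hxy : x = y
    · subst hxy
      exact (QF.holds_congr (tp₂_self_congr (tp_eq x)) (by simp) _).2 (hA.univ _ _)
    · obtain ⟨a, b, hab, e⟩ := old x y hxy
      exact (QF.holds_congr e (by simp [hxy, hab]) _).2 (hA.univ a b)
  · intro i x
    rcases witness x i with ⟨y, hy, -⟩ | h1
    · exact ⟨y, hy.1⟩
    · obtain ⟨y, hy, -⟩ := h1 _ le_rfl
      exact ⟨y, hy.1⟩
  · intro i x
    obtain ⟨b, hb, hb'⟩ := hA.delta i (val x)
    obtain ⟨y, hy, rfl⟩ := full x b (Or.inr hb)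
    have e := tp₂_eq x y hy.symm
    exact ⟨y, ⟨(bin_congr e T).1.2 hb.1, (bin_congr e T).2.2 hb.2⟩,
      (QF.holds_congr e ⟨fun h => congrArg val h, eq_of_pos_eq hy.symm⟩ _).2 hb'⟩
  · exact fun x y h => lev_eq_of_pos_eq ((simB x y).1 h)
  · intro x
    refine le_trans ?_ (hh (val x))
    have hinj : Set.InjOn val (cls T 𝔅 x) := by
      intro y hy z hz e
      exact eq_of_pos_eq (((simB x y).1 hy).symm.trans ((simB x z).1 hz)) e
    rw [← hinj.encard_image]
    refine Set.encard_le_encard ?_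
    rintro _ ⟨y, hy, rfl⟩
    exact hsim x y ((simB x y).1 hy)
  · intro x y x' y' hx hy h1 h2
    have he : x = y ↔ x' = y' := by
      have : lev x = lev y ↔ lev x' = lev y' := by omega
      rw [Copies.ext_iff, Copies.ext_iff, this, hx, hy]
    by_cases hxy : x = y
    · obtain rfl := he.1 hxy
      subst hxy
      refine tp₂_self_congr ?_
      rw [tp_eq, tp_eq, val_eq_of_core_eq hx]
    · have h3 := pos_lt_congr (T := T) (𝔄 := 𝔄) (up := up) hx hy h1 h2
      have h4 := pos_lt_congr (T := T) (𝔄 := 𝔄) (up := up) hy hx h2 h1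
      have h5 : p x = p y ↔ p x' = p y' := by
        rw [← not_iff_not, ← ne_eq, ← ne_eq, ne_iff_lt_or_gt, ne_iff_lt_or_gt]
        exact or_congr h3 h4
      have vx := val_eq_of_core_eq hx
      have vy := val_eq_of_core_eq hy
      have l1 : Lt x y = Lt x' y' := by
        simp only [Lt, CopyLt, vx, vy]
        rw [show (p x < p y) = (p x' < p y') from propext h3]
      have l2 : Lt y x = Lt y' x' := by
        simp only [Lt, CopyLt, vx, vy]
        rw [show (p y < p x) = (p y' < p x') from propext h4]
      refine symm x y x' y' hxy (mt he.2 hxy) (key_lt_congr hx hy h1 h2) vx vy h3 h4 ?_ ?_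
      · simp only [Want, vx, vy, ne_eq, h5, l1, l2, h1, tag_eq_of_core_eq hy]
      · simp only [Want, vx, vy, ne_eq, eq_comm (a := p y), eq_comm (a := p y'), h5, l1, l2, h2,
          tag_eq_of_core_eq hx]
  · intro x y hR e
    rw [prof_eq, prof_eq] at e
    rw [simB]
    by_contra hp
    exact hroyal x y hp (hR.2 _ e) hR

/-! ### Splices -/

theorem isIso_of_tp₂ {X Y : Set A} {f : X ≃ Y}
    (h : ∀ a b : X, tp₂ 𝔄 (f a : A) (f b) = tp₂ 𝔄 (a : A) b) : IsIso 𝔄 f := by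
  refine ⟨fun p a => ?_, fun r a b => (bin_congr (h a b) r).1⟩
  have := congrFun (congrArg (fun τ => τ.1.1) (h a a)) p
  exact iff_of_eq this

theorem IsIso.tp_eq {X Y : Set A} {f : X ≃ Y} (hf : IsIso 𝔄 f) (a : X) :
    tp 𝔄 (f a : A) = tp 𝔄 (a : A) :=
  Prod.ext (funext fun p => propext (hf.1 p a)) (funext fun r => propext (hf.2 r a a))

/-- Cliques with the same splice have the same profile. -/
theorem prof_eq_of_splice (ht : ∀ a b c : A, 𝔄.bin T a b → 𝔄.bin T b c → 𝔄.bin T a c)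
    {a b : A} (h : spliceSetoid T 𝔄 ⟨cls T 𝔄 a, isClique_cls ht a⟩
      ⟨cls T 𝔄 b, isClique_cls ht b⟩) : prof T 𝔄 a = prof T 𝔄 b := by
  obtain ⟨⟨f, hf⟩, h1, h2⟩ := h
  simp only [inTypes_cls ht, outTypes_cls ht] at h1 h2
  refine Prod.ext ?_ (Prod.ext h1 h2)
  ext t
  constructor
  · rintro ⟨c, hc, rfl⟩
    exact ⟨f ⟨c, hc⟩, (f ⟨c, hc⟩).2, hf.tp_eq ⟨c, hc⟩⟩
  · rintro ⟨c, hc, rfl⟩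
    refine ⟨f.symm ⟨c, hc⟩, (f.symm ⟨c, hc⟩).2, ?_⟩
    rw [← hf.tp_eq, Equiv.apply_symm_apply]

/-- If all cliques have at most `h` elements, a splice is determined by a structure on a subset of
`Fin h` and two sets of 1-types. -/
theorem finite_splice_and_card_le [Fintype U] [Fintype B] {h : ℕ}
    (hh : ∀ X, IsClique T 𝔄 X → X.encard ≤ (h : ℕ∞)) :
    Finite (Splice T 𝔄) ∧ Nat.card (Splice T 𝔄) ≤
      2 ^ (h + Fintype.card U * h + Fintype.card B * (h * h) +
        2 * 2 ^ (Fintype.card U + Fintype.card B)) := by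
  classical
  let Code := (Fin h → Prop) × (U × Fin h → Prop) × (B × Fin h × Fin h → Prop) ×
    (OneType U B → Prop) × (OneType U B → Prop)
  let ι := fun X : Clique T 𝔄 => (nonempty_embedding_fin (hh X.1 X.2)).some
  let code : Clique T 𝔄 → Code := fun X =>
    (fun k => k ∈ Set.range (ι X), fun q => ∃ a, ι X a = q.2 ∧ 𝔄.un q.1 a,
      fun q => ∃ a b, ι X a = q.2.1 ∧ ι X b = q.2.2 ∧ 𝔄.bin q.1 a b,
      InTypes T 𝔄 X.1, OutTypes T 𝔄 X.1)
  have code_un : ∀ X p (a : X.1), (code X).2.1 (p, ι X a) ↔ 𝔄.un p a := by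
    intro X p a
    simp only [code, EmbeddingLike.apply_eq_iff_eq, exists_eq_left]
  have code_bin : ∀ X r (a b : X.1), (code X).2.2.1 (r, ι X a, ι X b) ↔ 𝔄.bin r a b := by
    intro X r a b
    simp only [code, EmbeddingLike.apply_eq_iff_eq, exists_and_left, exists_eq_left]
  have hcode : ∀ X Y, code X = code Y → spliceSetoid T 𝔄 X Y := by
    intro X Y e
    have e1 : Set.range (ι X) = Set.range (ι Y) := congrArg (fun q => q.1) e
    have e2 := congrArg (fun q => q.2.1) e
    have e3 := congrArg (fun q => q.2.2.1) e
    have e4 : InTypes T 𝔄 X.1 = InTypes T 𝔄 Y.1 := congrArg (fun q => q.2.2.2.1) e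
    have e5 : OutTypes T 𝔄 X.1 = OutTypes T 𝔄 Y.1 := congrArg (fun q => q.2.2.2.2) e
    let f : X.1 ≃ Y.1 := (Equiv.ofInjective _ (ι X).injective).trans
      ((Equiv.setCongr e1).trans (Equiv.ofInjective _ (ι Y).injective).symm)
    have hf : ∀ a, ι Y (f a) = ι X a := by
      intro a
      exact Equiv.apply_ofInjective_symm (ι Y).injective _
    refine ⟨⟨f, fun p a => ?_, fun r a b => ?_⟩, e4, e5⟩
    · have e : (code X).2.1 (p, ι X a) = (code Y).2.1 (p, ι X a) := congrFun e2 _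
      rw [← code_un, ← code_un, e, hf]
    · have e : (code X).2.2.1 (r, ι X a, ι X b) = (code Y).2.2.1 (r, ι X a, ι X b) :=
        congrFun e3 _
      rw [← code_bin, ← code_bin, e, hf, hf]
  have hinj : Injective fun s : Splice T 𝔄 => code s.out := fun s s' e => by
    rw [← Quotient.out_eq s, ← Quotient.out_eq s']
    exact Quotient.sound (hcode _ _ e)
  refine ⟨Finite.of_injective _ hinj, (Nat.card_le_card_of_injective _ hinj).trans ?_⟩
  simp only [Code, Nat.card_prod, Nat.card_fun]
  simp only [Nat.card_eq_fintype_card, Fintype.card_prop, Fintype.card_fin, ← pow_add]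
  refine Nat.pow_le_pow_right (by norm_num) (le_of_eq ?_)
  ring

/-! ### Regularity of the layered model -/

namespace Copies

variable {I : Type} {S₀ S₁ : Set A}

/-- The copy of `x` at level `l + 1`, for `x` not in layer `0`. -/
def relevel (l : ℕ) : Copies I S₀ S₁ → Copies I S₀ S₁
  | .inl a => .inl a
  | .inr x => .inr (l, x.2)

theorem core_relevel (l : ℕ) (x : Copies I S₀ S₁) : core (relevel l x) = core x := by
  rcases x with a | x <;> rfl

theorem lev_relevel (l : ℕ) {x : Copies I S₀ S₁} (h : lev x ≠ 0) :
    lev (relevel l x) = l + 1 := by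
  rcases x with a | x
  · exact absurd rfl h
  · rfl

theorem relevel_relevel {l k : ℕ} {x : Copies I S₀ S₁} (h : lev x = k + 1) :
    relevel k (relevel l x) = x := by
  have h1 := lev_relevel l (x := x) (by omega)
  rw [ext_iff, core_relevel, core_relevel, lev_relevel k (by omega), h]
  exact ⟨rfl, rfl⟩

/-- Any two layers but layer `0` are copies of each other. -/
def layerEquiv (k l : ℕ) : {x : Copies I S₀ S₁ | lev x = k + 1} ≃
    {x : Copies I S₀ S₁ | lev x = l + 1} where
  toFun x := ⟨relevel l x, lev_relevel l (x.2.trans_ne (Nat.succ_ne_zero k))⟩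
  invFun x := ⟨relevel k x, lev_relevel k (x.2.trans_ne (Nat.succ_ne_zero l))⟩
  left_inv x := Subtype.ext (relevel_relevel x.2)
  right_inv x := Subtype.ext (relevel_relevel x.2)

end Copies

section layered

variable {Ψ : NormalForm U B} {h : ℕ} {I : Type} {S₀ S₁ : Set A} {𝔅 : Str U B (Copies I S₀ S₁)}

theorem IsLayered.tp₂_relevel (hL : IsLayered T Ψ 𝔄 h 𝔅) {x y : Copies I S₀ S₁}
    (hx : lev x ≠ 0) (hxy : lev x = lev y) (l : ℕ) :
    tp₂ 𝔅 (relevel l x) (relevel l y) = tp₂ 𝔅 x y := by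
  have h1 := lev_relevel l hx
  have h2 := lev_relevel l (hxy ▸ hx : lev y ≠ 0)
  exact hL.tp₂_congr _ _ _ _ (core_relevel _ _) (core_relevel _ _) (by omega) (by omega)

theorem IsLayered.isIso_layerEquiv (hL : IsLayered T Ψ 𝔄 h 𝔅) (k l : ℕ) :
    IsIso 𝔅 (layerEquiv (I := I) (S₀ := S₀) (S₁ := S₁) k l) :=
  isIso_of_tp₂ fun x y => hL.tp₂_relevel (x.2.trans_ne (Nat.succ_ne_zero k))
    (x.2.trans (Eq.symm y.2)) l

theorem IsLayered.sim_relevel (hL : IsLayered T Ψ 𝔄 h 𝔅) {x y : Copies I S₀ S₁}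
    (hx : lev x ≠ 0) (hS : Sim T 𝔅 x y) (l : ℕ) :
    Sim T 𝔅 (relevel l x) (relevel l y) := by
  have h1 := hL.tp₂_relevel hx (hL.lev_eq _ _ hS) l
  rcases hS with rfl | hS
  · exact Sim.refl _
  · exact Or.inr ⟨(bin_congr h1 T).1.2 hS.1, (bin_congr h1 T).2.2 hS.2⟩

/-- A clique outside layer `0` shares its splice with its copies in the other layers. -/
theorem IsLayered.K_subset (hL : IsLayered T Ψ 𝔄 h 𝔅) : K T 𝔅 ⊆ {x | lev x = 0} := by
  have ht := hL.isModel.trans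
  rintro x ⟨X, hx, hX⟩
  by_contra h0
  have h0 : lev x ≠ 0 := h0
  obtain ⟨k, hk⟩ := Nat.exists_eq_succ_of_ne_zero h0
  let x' := relevel (k + 1) x
  have hx' : lev x' = k + 2 := lev_relevel _ h0
  have hlev : ∀ y : cls T 𝔅 x, lev y.1 = k + 1 := fun y => (hL.lev_eq _ _ y.2).symm.trans hk
  have hlev' : ∀ y : cls T 𝔅 x', lev y.1 = k + 2 := fun y =>
    (hL.lev_eq _ _ y.2).symm.trans hx'
  let f : cls T 𝔅 x ≃ cls T 𝔅 x' :=
    { toFun := fun y => ⟨relevel (k + 1) y, hL.sim_relevel h0 y.2 _⟩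
      invFun := fun y => ⟨relevel k y, by
        have h1 := hL.sim_relevel (x := x') (by omega) y.2 k
        rwa [relevel_relevel hk] at h1⟩
      left_inv := fun y => Subtype.ext (relevel_relevel (hlev y))
      right_inv := fun y => Subtype.ext (relevel_relevel (hlev' y)) }
  have hf : IsIso 𝔅 f := isIso_of_tp₂ fun y z =>
    hL.tp₂_relevel (by rw [hlev]; omega) (by rw [hlev, hlev]) _
  have hp : prof T 𝔅 x = prof T 𝔅 x' := by
    rw [hL.prof_eq, hL.prof_eq, val_eq_of_core_eq (core_relevel (k + 1) x)]
  have hXx : X = ⟨cls T 𝔅 x, isClique_cls ht x⟩ := Subtype.ext (X.2.eq_cls ht hx)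
  have h1 := hX ⟨cls T 𝔅 x', isClique_cls ht x'⟩ (by
    rw [hXx]
    refine ⟨⟨f, hf⟩, ?_, ?_⟩
    · rw [inTypes_cls ht, inTypes_cls ht, hp]
    · rw [outTypes_cls ht, outTypes_cls ht, hp])
  have h2 : x ∈ cls T 𝔅 x' := by
    rw [← h1] at hx
    exact hx
  have := hL.lev_eq _ _ h2
  omega

theorem IsLayered.mem_K (hL : IsLayered T Ψ 𝔄 h 𝔅) {x : Copies I S₀ S₁}
    (hx : Royal T 𝔄 (val x)) : x ∈ K T 𝔅 := by
  have ht := hL.isModel.trans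
  have := hL.isModel.nonempty
  refine ⟨⟨cls T 𝔅 x, isClique_cls ht x⟩, Sim.refl x, ?_⟩
  rintro ⟨Y, hY⟩ hXY
  obtain ⟨y, hy⟩ := hY.nonempty
  obtain rfl := hY.eq_cls ht hy
  have h1 := hL.sim_of_royal x y hx (prof_eq_of_splice ht hXY).symm
  exact Subtype.ext ((cls_eq_iff ht).2 h1.symm)

end layered

/-- The profiles of `𝔄` are at most as many as the splices of the layered structure. -/
theorem IsLayered.card_prof_le {Ψ : NormalForm U B} {h : ℕ} {I : Type} {S₀ S₁ : Set A}
    {𝔅 : Str U B (Copies I S₀ S₁)} (hL : IsLayered T Ψ 𝔄 h 𝔅) [Finite (Splice T 𝔅)]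
    (hval : ∀ a, ∃ x : Copies I S₀ S₁, prof T 𝔄 (val x) = prof T 𝔄 a) :
    Nat.card (Set.range (prof T 𝔄)) ≤ Nat.card (Splice T 𝔅) := by
  have ht := hL.isModel.trans
  have h1 : ∀ p : Set.range (prof T 𝔄), ∃ x : Copies I S₀ S₁, prof T 𝔅 x = p := by
    rintro ⟨_, a, rfl⟩
    obtain ⟨x, hx⟩ := hval a
    exact ⟨x, (hL.prof_eq x).trans hx⟩
  choose x hx using h1
  refine Nat.card_le_card_of_injective
    (fun p => (Quotient.mk _ ⟨cls T 𝔅 (x p), isClique_cls ht (x p)⟩ : Splice T 𝔅)) ?_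
  intro p q e
  rw [Subtype.ext_iff, ← hx p, ← hx q]
  exact prof_eq_of_splice ht (Quotient.exact e)

theorem IsLayered.isRegularModel {Ψ : NormalForm U B} {h H : ℕ} {S₀ S₁ : Set A}
    {𝔅 : Str U B (Copies (Fin Ψ.m ⊕ Bool) S₀ S₁)} (hL : IsLayered T Ψ 𝔄 h 𝔅) (hH : h ≤ H)
    (hne : S₀.Nonempty) (hfin₀ : S₀.Finite) (hfin₁ : S₁.Finite)
    (hr₁ : ∀ a, a ∈ S₁ → ¬ Royal T 𝔄 a) (hr : S₁ = ∅ → ∀ a, Royal T 𝔄 a)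
    (hc₀ : Nat.card S₀ ≤ segmentBound T Ψ 𝔅 H)
    (hc₁ : (Ψ.m + 2) * Nat.card S₁ ≤ segmentBound T Ψ 𝔅 H) : IsRegularModel T Ψ 𝔅 H := by
  have ht := hL.isModel.trans
  have := hL.isModel.nonempty
  have := hfin₀.to_subtype
  have := hfin₁.to_subtype
  refine ⟨hL.isModel, fun X hX => ?_, ?_⟩
  · obtain ⟨x, hx⟩ := hX.nonempty
    rw [hX.eq_cls ht hx]
    exact (hL.clique_le x).trans (Nat.cast_le.2 hH)
  by_cases hS : S₁ = ∅
  · subst hS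
    refine Or.inl ⟨inferInstance, Set.eq_univ_of_forall fun x => hL.mem_K (hr rfl _)⟩
  obtain ⟨s, hs⟩ := Set.nonempty_iff_ne_empty.2 hS
  refine Or.inr ⟨fun j => {x | lev x = j}, ⟨?_, ?_, ?_, ?_, hL.K_subset, ?_, ?_⟩, ?_, ?_⟩
  · rintro (_ | k)
    · exact ⟨.inl ⟨_, hne.some_mem⟩, rfl⟩
    · exact ⟨.inr ⟨k, .inr true, ⟨s, hs⟩⟩, rfl⟩
  · intro j k hjk
    exact Set.disjoint_left.2 fun x h1 h2 => hjk (h1.symm.trans h2)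
  · exact Set.eq_univ_of_forall fun x => Set.mem_iUnion.2 ⟨lev x, rfl⟩
  · rintro j X hX ⟨x, hx, hj⟩ y hy
    rw [hX.eq_cls ht hx] at hy
    exact (hL.lev_eq _ _ hy).symm.trans hj
  · rintro (_ | k)
    · have hsub : {x : Copies (Fin Ψ.m ⊕ Bool) S₀ S₁ | lev x = 0} ⊆
          Set.range (Sum.inl : S₀ → _) := by
        rintro (a | x) hx
        · exact ⟨a, rfl⟩
        · exact absurd hx (Nat.succ_ne_zero _)
      exact (encard_le_of_subset_range hsub).trans (Nat.cast_le.2 hc₀)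
    · have hsub : {x : Copies (Fin Ψ.m ⊕ Bool) S₀ S₁ | lev x = k + 1} ⊆
          Set.range (fun q : (Fin Ψ.m ⊕ Bool) × S₁ => Sum.inr (k, q)) := by
        rintro (a | ⟨l, q⟩) hx
        · exact absurd hx.symm (Nat.succ_ne_zero _)
        · obtain rfl : l = k := Nat.succ_injective hx
          exact ⟨q, rfl⟩
      refine (encard_le_of_subset_range hsub).trans (Nat.cast_le.2 (le_trans (le_of_eq ?_) hc₁))
      rw [Nat.card_prod, Nat.card_sum, Nat.card_fin, Nat.card_eq_fintype_card (α := Bool),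
        Fintype.card_bool]
  · intro j k hkj x hx i hi
    rcases hL.witness x i with ⟨y, hy, hy'⟩ | h1
    · have : y ∈ Wit T Ψ 𝔅 i x ∩ {x | lev x = 0} := ⟨hy, hy'⟩
      rw [hi] at this
      exact this.elim
    · obtain ⟨y, hy, hy'⟩ := h1 j (hx.trans_le hkj)
      exact ⟨y, hy, hy'⟩
  · intro j' k' j k hj' hjk' hj hjk
    refine ⟨hjk', hjk, ?_⟩
    obtain ⟨j', rfl⟩ := Nat.exists_eq_add_one_of_ne_zero (Nat.one_le_iff_ne_zero.1 hj')
    obtain ⟨j, rfl⟩ := Nat.exists_eq_add_one_of_ne_zero (Nat.one_le_iff_ne_zero.1 hj)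
    obtain ⟨k', rfl⟩ := Nat.exists_eq_add_one_of_ne_zero (show k' ≠ 0 by omega)
    obtain ⟨k, rfl⟩ := Nat.exists_eq_add_one_of_ne_zero (show k ≠ 0 by omega)
    refine ⟨layerEquiv j' j, layerEquiv k' k, hL.isIso_layerEquiv _ _, hL.isIso_layerEquiv _ _,
      fun x y => hL.tp₂_congr _ _ _ _ (core_relevel _ _).symm (core_relevel _ _).symm ?_ ?_⟩ <;>
    · rw [(layerEquiv j' j x).2, (layerEquiv k' k y).2, x.2, y.2]
      omega
  · intro k' k hk' hk
    refine ⟨hk', hk, ?_⟩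
    obtain ⟨k', rfl⟩ := Nat.exists_eq_add_one_of_ne_zero (Nat.one_le_iff_ne_zero.1 hk')
    obtain ⟨k, rfl⟩ := Nat.exists_eq_add_one_of_ne_zero (Nat.one_le_iff_ne_zero.1 hk)
    refine ⟨Equiv.refl _, layerEquiv k' k, isIso_of_tp₂ fun _ _ => rfl, hL.isIso_layerEquiv _ _,
      fun x y => hL.tp₂_congr _ _ _ _ rfl (core_relevel _ _).symm ?_ ?_⟩ <;>
    · rw [(layerEquiv k' k y).2, y.2, Equiv.refl_apply, x.2]
      omega

/-! ### Selecting the cliques to be copied -/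

/-- `S₁` consists of one clique of each profile that is not royal. `S₀` consists of one clique of
each profile and of the cliques of the chosen witnesses of royal elements. -/
theorem exists_selection [Finite U] [Finite B] [Nonempty A]
    (ht : ∀ a b c : A, 𝔄.bin T a b → 𝔄.bin T b c → 𝔄.bin T a c) {h : ℕ}
    (hh : ∀ a, (cls T 𝔄 a).encard ≤ (h : ℕ∞)) {m : ℕ} (g : Fin m → A → A) :
    ∃ S₀ S₁ : Set A, S₀.Nonempty ∧ (∀ a b, Sim T 𝔄 a b → a ∈ S₀ → b ∈ S₀) ∧
      (∀ a b, Sim T 𝔄 a b → a ∈ S₁ → b ∈ S₁) ∧ (∀ a, Royal T 𝔄 a → a ∈ S₀) ∧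
      (∀ a, a ∈ S₁ → ¬ Royal T 𝔄 a) ∧ (∀ i a, Royal T 𝔄 a → g i a ∈ S₀) ∧
      (∀ a, ¬ Royal T 𝔄 a →
        ∃ b ∈ S₁, prof T 𝔄 b = prof T 𝔄 a ∧ tp 𝔄 b = tp 𝔄 a) ∧
      S₀.Finite ∧ Nat.card S₀ ≤ Nat.card (Set.range (prof T 𝔄)) * (h * (m * h + 1)) ∧
      S₁.Finite ∧ Nat.card S₁ ≤ Nat.card (Set.range (prof T 𝔄)) * h := by
  have bound : ∀ {ι : Type _} [Finite ι] {C : Set A} {f : ι → A}, C ⊆ Set.range f →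
      C.Finite ∧ Nat.card C ≤ Nat.card ι := by
    intro ι _ C f hC
    have h1 := encard_le_of_subset_range hC
    have h2 := Set.finite_of_encard_le_coe h1
    rw [← h2.cast_ncard_eq, Nat.cast_le] at h1
    exact ⟨h2, h1⟩
  let r : Profile U B → A := invFun (prof T 𝔄)
  have hr : ∀ a, prof T 𝔄 (r (prof T 𝔄 a)) = prof T 𝔄 a := fun a => invFun_eq ⟨a, rfl⟩
  let Sel : Set A := {a | Sim T 𝔄 (r (prof T 𝔄 a)) a}
  have hSel : ∀ a b, Sim T 𝔄 a b → a ∈ Sel → b ∈ Sel := by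
    intro a b hab ha
    simp only [Sel, Set.mem_ofPred_eq, ← hab.prof_eq ht]
    exact ha.trans ht hab
  have hrep : ∀ a, ∃ b ∈ Sel, prof T 𝔄 b = prof T 𝔄 a ∧ tp 𝔄 b = tp 𝔄 a := by
    intro a
    obtain ⟨b, hb, hb'⟩ : tp 𝔄 a ∈ (prof T 𝔄 (r (prof T 𝔄 a))).1 := by
      rw [hr]
      exact ⟨a, Sim.refl a, rfl⟩
    have e : prof T 𝔄 b = prof T 𝔄 a := by rw [← hb.prof_eq ht, hr]
    refine ⟨b, ?_, e, hb'⟩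
    simp only [Sel, Set.mem_ofPred_eq, e]
    exact hb
  have hroyal : ∀ a, Royal T 𝔄 a → a ∈ Sel := fun a ha => (ha.2 _ (hr a)).symm
  choose e he using fun a => exists_subset_range_of_embedding
    (nonempty_embedding_fin (hh a)).some
  let P := Set.range (prof T 𝔄)
  have hcov : ∀ a ∈ Sel, ∃ (p : P) (j : Fin h), e (r p) j = a := fun a ha =>
    let ⟨j, hj⟩ := he _ ha
    ⟨⟨_, a, rfl⟩, j, hj⟩
  let S₀ : Set A := Sel ∪ {b | ∃ i a, Royal T 𝔄 a ∧ Sim T 𝔄 (g i a) b}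
  let S₁ : Set A := {a | a ∈ Sel ∧ ¬ Royal T 𝔄 a}
  have h0 : S₀ ⊆ Set.range (fun q : P × Fin h × Option (Fin m × Fin h) =>
      q.2.2.elim (e (r q.1) q.2.1) fun ij => e (g ij.1 (e (r q.1) q.2.1)) ij.2) := by
    rintro b (hb | ⟨i, a, ha, hb⟩)
    · obtain ⟨p, j, rfl⟩ := hcov b hb
      exact ⟨(p, j, none), rfl⟩
    · obtain ⟨p, j, rfl⟩ := hcov a (hroyal a ha)
      obtain ⟨j', rfl⟩ := he _ hb
      exact ⟨(p, j, some (i, j')), rfl⟩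
  have h1 : S₁ ⊆ Set.range (fun q : P × Fin h => e (r q.1) q.2) := by
    rintro a ⟨ha, -⟩
    obtain ⟨p, j, rfl⟩ := hcov a ha
    exact ⟨(p, j), rfl⟩
  obtain ⟨f0, c0⟩ := bound h0
  obtain ⟨f1, c1⟩ := bound h1
  refine ⟨S₀, S₁, ?_, ?_, ?_, fun a ha => Or.inl (hroyal a ha), fun a ha => ha.2,
    fun i a ha => Or.inr ⟨i, a, ha, Sim.refl _⟩, ?_, f0, ?_, f1, ?_⟩
  · obtain ⟨b, hb, -⟩ := hrep (Classical.arbitrary A)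
    exact ⟨b, Or.inl hb⟩
  · rintro a b hab (ha | ⟨i, c, hc, ha⟩)
    · exact Or.inl (hSel a b hab ha)
    · exact Or.inr ⟨i, c, hc, ha.trans ht hab⟩
  · exact fun a b hab ha => ⟨hSel a b hab ha.1, fun hb => ha.2 (hb.of_sim ht hab.symm)⟩
  · intro a ha
    obtain ⟨b, hb, hp, htp⟩ := hrep a
    refine ⟨b, ⟨hb, fun hR => ha ?_⟩, hp, htp⟩
    exact hR.of_sim ht (hR.2 a hp.symm)
  · refine c0.trans (le_of_eq ?_)
    rw [Nat.card_prod, Nat.card_prod, Finite.card_option, Nat.card_prod, Nat.card_fin,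
      Nat.card_fin]
  · refine c1.trans (le_of_eq ?_)
    rw [Nat.card_prod, Nat.card_fin]

end

end FO2T

/-- Every satisfiable normal-form sentence of the two-variable fragment with one transitive
relation and transitive witnesses has a regular model. The clique size is at most exponential and
the number of splices at most doubly exponential in the size of the signature, with absolute
constants. -/
theorem mainTheorem3 :
    ∃ c d : ℕ, ∀ (U : Type u) (B : Type v) [Fintype U] [Fintype B] (T : B)
      (Ψ : FO2T.NormalForm U B), FO2T.Satisfiable.{u, v, w} T Ψ →
      ∃ (A : Type) (𝔄 : FO2T.Str U B A),
        FO2T.IsRegularModel T Ψ 𝔄 (2 ^ (c * (Fintype.card U + Fintype.card B))) ∧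
        Nat.card (FO2T.Splice T 𝔄) ≤ 2 ^ (2 ^ (d * (Fintype.card U + Fintype.card B))) := by
  -- Cliques have at most `h = 2 ^ (16 * n)` elements. The bound `2 ^ (32 * n) = h * h` leaves room
  -- for the witness cliques of all elements of the royal cliques in layer `0`.
  refine ⟨32, 67, ?_⟩
  intro U B _ _ T Ψ hΨ
  obtain ⟨A₀, 𝔄₀, hA₀⟩ := FO2T.exists_model_type_zero hΨ
  obtain ⟨A, 𝔄, hA, hh⟩ := hA₀.exists_small_cliques
  have := hA.nonempty
  have : Nonempty B := ⟨T⟩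
  set n := Fintype.card U + Fintype.card B with hn
  have hn1 : 1 ≤ n := le_add_left Fintype.card_pos
  choose g hg using hA.gamma
  obtain ⟨S₀, S₁, hne, h₀, h₁, hr₀, hr₁, hgr, hrep, hf₀, hc₀, hf₁, hc₁⟩ :=
    FO2T.exists_selection hA.trans hh g
  obtain ⟨𝔅, hL⟩ := hA.exists_isLayered hh hg hne h₀ h₁ hr₀ hr₁ hgr hrep
  set h := 2 ^ (16 * n) with hdef
  have h2 : 2 ≤ h := Nat.le_self_pow (by omega) 2
  have hsq : 2 ^ (32 * n) = h * h := by rw [hdef, ← pow_add]; congr 1; ring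
  have hle : h ≤ h * h := Nat.le_mul_self h
  have hBne := hL.isModel.nonempty
  have hcl : ∀ X, FO2T.IsClique T 𝔅 X → X.encard ≤ ((h * h : ℕ) : ℕ∞) := by
    intro X hX
    obtain ⟨x, hx⟩ := hX.nonempty
    rw [hX.eq_cls hL.isModel.trans hx]
    exact (hL.clique_le x).trans (Nat.cast_le.2 hle)
  obtain ⟨hfin, hcard⟩ := FO2T.finite_splice_and_card_le hcl
  have hs := hL.card_prof_le fun a => by
    by_cases ha : FO2T.Royal T 𝔄 a
    · exact ⟨.inl ⟨a, hr₀ a ha⟩, rfl⟩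
    · obtain ⟨b, hb, hp, -⟩ := hrep a ha
      exact ⟨.inr ⟨0, .inr true, ⟨b, hb⟩⟩, hp⟩
  set s := Nat.card (FO2T.Splice T 𝔅) with hsdef
  have hs2 : s ≤ s ^ 2 := Nat.le_self_pow two_ne_zero s
  refine ⟨_, 𝔅, ?_, ?_⟩
  · rw [hsq]
    refine hL.isRegularModel hle hne hf₀ hf₁ hr₁ ?_ ?_ ?_
    · intro hS a
      by_contra ha
      obtain ⟨b, hb, -⟩ := hrep a ha
      rw [hS] at hb
      exact hb
    · have h3 : h * (Ψ.m * h + 1) ≤ (Ψ.m + 1) * (h * h) := by nlinarith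
      calc Nat.card S₀ ≤ _ := hc₀
        _ ≤ s ^ 2 * ((Ψ.m + 1) * (h * h)) := Nat.mul_le_mul (hs.trans hs2) h3
        _ = FO2T.segmentBound T Ψ 𝔅 (h * h) := by rw [FO2T.segmentBound, ← hsdef]; ring
    · have h3 : (Ψ.m + 2) * h ≤ (Ψ.m + 1) * (h * h) := by nlinarith [Nat.zero_le Ψ.m]
      calc (Ψ.m + 2) * Nat.card S₁ ≤ (Ψ.m + 2) * (s ^ 2 * h) :=
            Nat.mul_le_mul_left _ (hc₁.trans (Nat.mul_le_mul_right _ (hs.trans hs2)))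
        _ = s ^ 2 * ((Ψ.m + 2) * h) := by ring
        _ ≤ s ^ 2 * ((Ψ.m + 1) * (h * h)) := Nat.mul_le_mul_left _ h3
        _ = FO2T.segmentBound T Ψ 𝔅 (h * h) := by rw [FO2T.segmentBound, ← hsdef]; ring
  · refine hcard.trans (Nat.pow_le_pow_right two_pos ?_)
    set H := h * h with hH
    have hnlt : n < 2 ^ n := Nat.lt_two_pow_self
    have hHH : H ≤ H * H := Nat.le_mul_self H
    have hpH : 2 ^ n ≤ H * H := by
      refine le_trans ?_ hHH
      rw [← hsq]
      exact Nat.pow_le_pow_right two_pos (by omega)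
    have h4 : n + 3 ≤ 2 ^ (3 * n) := by
      have h5 : 2 ^ (n + 2) ≤ 2 ^ (3 * n) := Nat.pow_le_pow_right two_pos (by omega)
      rw [pow_add] at h5
      omega
    calc H + Fintype.card U * H + Fintype.card B * (H * H) + 2 * 2 ^ n
        ≤ H * H + Fintype.card U * (H * H) + Fintype.card B * (H * H) + 2 * (H * H) := by
          gcongr
      _ = (n + 3) * (H * H) := by rw [hn]; ring
      _ ≤ 2 ^ (3 * n) * (H * H) := Nat.mul_le_mul_right _ h4
      _ = 2 ^ (67 * n) := by rw [← hsq, ← pow_add, ← pow_add]; congr 1; ring
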